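/- Let $C$ be a smooth projective (irreducible) curve over an algebraically closed field $K$. A subbundle of a vector bundle $E$ on $C$ is a subsheaf $F\subset E$ such that $F$ and $E/F$ are vector bundles. For a vector bundle $E$ of rank $r$ on $C$ and an integer $1\le k\le r-1$ put $$s_k(E):=\min_F\,\bigl(k\deg E-r\deg F\bigr),$$ where $F$ runs over the subbundles of rank $k$ of $E$; a subbundle of rank $k$ is called maximal if it has maximal degree among the subbundles of rank $k$ of $E$. **Proposition 4.3.** Let $E$ be a stable vector bundle of rank $r$ and degree $d$ on $C$, let $1\le k\le r-1$ with $s_k(E)=s$, and let $F$ be a maximal subbundle of rank $k$ of $E$. Then (i) $s_\nu(F)\ge \frac1r\,(k-\nu s)$ for all $1\le\nu\le k-1$; (ii) $s_\nu(E/F)\ge \frac1r\,\bigl((r-k)-(r-k-\nu)s\bigr)$ for all $1\le\nu\le r-k-1$. -/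

import Mathlib

universe u

namespace CurveBundle

open CategoryTheory CategoryTheory.Limits AlgebraicGeometry

/-- A smooth projective curve over the field `K`: an integral scheme which is proper and smooth of
relative dimension one over `K`. (A proper curve over a field is automatically projective.) -/
structure SmoothProjectiveCurve (K : Type u) [Field K] where
  /-- The underlying scheme. -/
  X : Scheme.{u}
  /-- The structure morphism. -/
  hom : X ⟶ Spec (.of K)
  isIntegral : IsIntegral X
  isProper : IsProper hom
  smooth : SmoothOfRelativeDimension 1 hom

attribute [instance] SmoothProjectiveCurve.isIntegral SmoothProjectiveCurve.isProper
  SmoothProjectiveCurve.smooth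

instance {K : Type u} [Field K] (C : SmoothProjectiveCurve K) : IsLocallyNoetherian C.X :=
  LocallyOfFiniteType.isLocallyNoetherian C.hom

section Frames

variable {X : Scheme.{u}}

/-- Restriction of a section of an `𝒪_X`-module to a smaller open set. -/
noncomputable def res (M : X.Modules) {U V : X.Opens} (h : V ≤ U) (s : Γ(M, U)) : Γ(M, V) :=
  M.presheaf.map (homOfLE h).op s

/-- The sections `e₁, …, eₙ` of `M` over `U` form a frame (a local trivialization) of `M` on `U`:
the morphism `𝒪_U ^ n ⟶ M|_U` they define is an isomorphism, that is, it is bijective on sections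
over every open subset of `U`. -/
def IsFrame (M : X.Modules) {n : ℕ} (U : X.Opens) (e : Fin n → Γ(M, U)) : Prop :=
  ∀ (V : X.Opens) (h : V ≤ U),
    Function.Bijective fun a : Fin n → Γ(X, V) ↦ ∑ i, a i • res M h (e i)

/-- `M` is a vector bundle of rank `n`, i.e. an `𝒪_X`-module locally isomorphic to `𝒪_X ^ n`. -/
def IsVectorBundle (n : ℕ) (M : X.Modules) : Prop :=
  ∀ x : X, ∃ U : X.Opens, x ∈ U ∧ ∃ e : Fin n → Γ(M, U), IsFrame M U e

/-- A subbundle of rank `k` of `E`: a subsheaf which is a vector bundle of rank `k` such that the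
quotient sheaf is again a vector bundle. -/
structure Subbundle (E : X.Modules) (k : ℕ) where
  /-- The underlying `𝒪_X`-module. -/
  obj : X.Modules
  /-- The inclusion. -/
  ι : obj ⟶ E
  mono : Mono ι
  isVectorBundle : IsVectorBundle k obj
  exists_isVectorBundle_cokernel : ∃ q : ℕ, IsVectorBundle q (cokernel ι)

/-- The quotient bundle `E / F` (the cokernel of `F ⟶ E` in the category of `𝒪_X`-modules). -/
noncomputable def Subbundle.quotient {E : X.Modules} {k : ℕ} (F : Subbundle E k) : X.Modules :=
  cokernel F.ι

end Frames

section Degree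

variable {X : Scheme.{u}} [IsIntegral X]

/-- `g ∈ K(X)` is the determinant of the transition matrix `A` expressing `b` (sections over `U`)
in terms of `e` (sections over `V`): `b j = ∑ i, A i j • e i` on some nonempty open `W ⊆ U ∩ V`. -/
def IsTransitionDet (M : X.Modules) {n : ℕ} {U V : X.Opens} (b : Fin n → Γ(M, U))
    (e : Fin n → Γ(M, V)) (g : X.functionField) : Prop :=
  ∃ (W : X.Opens) (hU : W ≤ U) (hV : W ≤ V) (_ : Nonempty W)
    (A : Matrix (Fin n) (Fin n) Γ(X, W)),
    (∀ j, res M hU (b j) = ∑ i, A i j • res M hV (e i)) ∧ g = X.germToFunctionField W A.det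

variable [IsLocallyNoetherian X]

/-- The rational section `b₁ ∧ … ∧ bₙ` of `det M` vanishes to order `m` at the point `x`: in terms
of a frame `e` of `M` around `x`, it is `g • (e₁ ∧ … ∧ eₙ)` with `ord_x g = m`. -/
def HasOrderAt (M : X.Modules) {n : ℕ} {U : X.Opens} (b : Fin n → Γ(M, U)) (x : X) (m : ℤ) :
    Prop :=
  ∃ (V : X.Opens) (e : Fin n → Γ(M, V)) (g : X.functionField),
    x ∈ V ∧ IsFrame M V e ∧ IsTransitionDet M b e g ∧ X.ord g x = m

/-- `d` is the degree of the divisor of a rational section `b₁ ∧ … ∧ bₙ` of `det M`, where `b` is a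
frame of `M` over some nonempty open set. The sum is over all points of `X`; only points of
codimension one (on a curve: closed points) contribute. Over an algebraically closed field the
closed points of a curve all have residue degree one. -/
def IsDegree (M : X.Modules) (d : ℤ) : Prop :=
  ∃ (n : ℕ) (U : X.Opens) (b : Fin n → Γ(M, U)) (m : X → ℤ),
    Nonempty U ∧ IsFrame M U b ∧ (∀ x, HasOrderAt M b x (m x)) ∧ m.support.Finite ∧
      d = ∑ᶠ x, m x

open Classical in
/-- The degree of a vector bundle `M` on a smooth projective curve over an algebraically closed
field, i.e. the degree of the divisor of any nonzero rational section of `det M`. -/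
noncomputable def degree (M : X.Modules) : ℤ :=
  if h : ∃ d, IsDegree M d then h.choose else 0

/-- The integer `s_k(E, F) = k deg E - r deg F`, for a subbundle `F` of rank `k` of a vector bundle
`E` of rank `r`. -/
noncomputable def segreOf (r : ℕ) {k : ℕ} (E : X.Modules) (F : Subbundle E k) : ℤ :=
  k * degree E - r * degree F.obj

/-- The invariant `s_k(E)` of a vector bundle `E` of rank `r`: the minimum of `s_k(E, F)` over all
subbundles `F` of rank `k` of `E`. -/
noncomputable def segre (r k : ℕ) (E : X.Modules) : ℤ :=
  sInf (Set.range fun F : Subbundle E k ↦ segreOf r E F)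

/-- A maximal subbundle of rank `k`: one of maximal degree among the subbundles of rank `k`. -/
def Subbundle.IsMaximal {E : X.Modules} {k : ℕ} (F : Subbundle E k) : Prop :=
  ∀ G : Subbundle E k, degree G.obj ≤ degree F.obj

/-- `E` (more precisely, its isomorphism class) is a point of the moduli space of stable vector
bundles of rank `r` and degree `d`: `E` is a vector bundle of rank `r` and degree `d`, and the slope
of every subbundle of rank `1 ≤ k ≤ r - 1` is smaller than the slope of `E`. -/
structure IsStableBundle (r : ℕ) (d : ℤ) (E : X.Modules) : Prop where
  isVectorBundle : IsVectorBundle r E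
  degree_eq : degree E = d
  slope_lt : ∀ k : ℕ, 1 ≤ k → k < r → ∀ F : Subbundle E k,
    (degree F.obj : ℚ) / k < (degree E : ℚ) / r

end Degree

end CurveBundle

namespace CurveBundle

open CategoryTheory CategoryTheory.Limits AlgebraicGeometry

section Sections

variable {X : Scheme.{u}} {M N : X.Modules}

@[simp] lemma res_rfl {U : X.Opens} (s : Γ(M, U)) : res M le_rfl s = s := by
  change M.presheaf.map (𝟙 (Opposite.op U)) s = s
  simp

@[simp] lemma res_res {U V W : X.Opens} (h : V ≤ U) (h' : W ≤ V) (s : Γ(M, U)) :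
    res M h' (res M h s) = res M (h'.trans h) s := by
  change (M.presheaf.map (homOfLE h).op ≫ M.presheaf.map (homOfLE h').op) s = _
  rw [← Functor.map_comp]; rfl

@[simp] lemma res_add {U V : X.Opens} (h : V ≤ U) (s t : Γ(M, U)) :
    res M h (s + t) = res M h s + res M h t :=
  map_add (M.presheaf.map (homOfLE h).op).hom s t

@[simp] lemma res_zero {U V : X.Opens} (h : V ≤ U) : res M h (0 : Γ(M, U)) = 0 :=
  map_zero (M.presheaf.map (homOfLE h).op).hom

@[simp] lemma res_sum {ι : Type*} {U V : X.Opens} (h : V ≤ U) (S : Finset ι) (s : ι → Γ(M, U)) :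
    res M h (∑ i ∈ S, s i) = ∑ i ∈ S, res M h (s i) :=
  map_sum (M.presheaf.map (homOfLE h).op).hom s S

@[simp] lemma res_smul {U V : X.Opens} (h : V ≤ U) (a : Γ(X, U)) (s : Γ(M, U)) :
    res M h (a • s) = (X.presheaf.map (homOfLE h).op) a • res M h s :=
  Scheme.Modules.map_smul M (homOfLE h) a s

@[simp] lemma app_res {U V : X.Opens} (φ : M ⟶ N) (h : V ≤ U) (s : Γ(M, U)) :
    φ.app V (res M h s) = res N h (φ.app U s) :=
  ConcreteCategory.congr_hom (φ.mapPresheaf.naturality (homOfLE h).op) s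

/-- Sections of a sheaf of modules which agree locally are equal. -/
lemma eq_of_res_eq {U : X.Opens} {s t : Γ(M, U)}
    (h : ∀ x ∈ U, ∃ (V : X.Opens) (hV : V ≤ U), x ∈ V ∧ res M hV s = res M hV t) : s = t := by
  choose V hV hx hst using h
  refine TopCat.Sheaf.eq_of_locally_eq' (F := (⟨M.presheaf, M.isSheaf⟩ : TopCat.Sheaf Ab X))
    (fun x : U ↦ V x x.2) U (fun x ↦ homOfLE (hV x x.2)) ?_ s t fun x ↦ hst x x.2
  intro x hxU
  exact TopologicalSpace.Opens.mem_iSup.mpr ⟨⟨x, hxU⟩, hx x hxU⟩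

variable (M) in
/-- A family of submodules of the sections of `M`, stable under restriction and of local nature. -/
structure LocalSubmodule where
  obj (U : X.Opens) : Submodule Γ(X, U) Γ(M, U)
  res_mem {U V : X.Opens} (h : V ≤ U) {s : Γ(M, U)} : s ∈ obj U → res M h s ∈ obj V
  mem_of_local {U : X.Opens} {s : Γ(M, U)} :
    (∀ x ∈ U, ∃ (V : X.Opens) (h : V ≤ U), x ∈ V ∧ res M h s ∈ obj V) → s ∈ obj U

namespace LocalSubmodule

variable (N : LocalSubmodule M)

/-- The subpresheaf of modules underlying a local family of submodules. -/
noncomputable def toSubmodule : PresheafOfModules.Submodule (SheafOfModules.val M) where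
  obj U := N.obj U.unop
  map f _ hs := N.res_mem (leOfHom f.unop) hs

/-- The subsheaf of modules given by a local family of submodules. -/
noncomputable def toModules : X.Modules where
  val := N.toSubmodule.toPresheafOfModules
  isSheaf := by
    refine (TopCat.Presheaf.isSheaf_iff_isSheafUniqueGluing _).mpr fun ι U sf hsf ↦ ?_
    let sf' : ∀ i, Γ(M, U i) := fun i ↦ Subtype.val (p := (· ∈ N.obj (U i))) (sf i)
    obtain ⟨s, hs, hu⟩ := TopCat.Sheaf.existsUnique_gluing
      (F := (⟨M.presheaf, M.isSheaf⟩ : TopCat.Sheaf Ab X)) U sf'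
      (fun i j ↦ congrArg Subtype.val (hsf i j))
    refine ⟨⟨s, ?_⟩, ?_, ?_⟩
    · refine N.mem_of_local fun x hx ↦ ?_
      obtain ⟨i, hi⟩ := TopologicalSpace.Opens.mem_iSup.mp hx
      refine ⟨U i, le_iSup U i, hi, ?_⟩
      have := hs i
      change res M (le_iSup U i) s = _ at this
      rw [this]
      exact (sf i).2
    · exact fun i ↦ Subtype.ext (hs i)
    · exact fun t ht ↦ Subtype.ext (hu t.1 fun i ↦ congrArg Subtype.val (ht i))

/-- The inclusion of the subsheaf of modules given by a local family of submodules. -/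
noncomputable def ι : N.toModules ⟶ M := SheafOfModules.Hom.mk N.toSubmodule.ι

lemma ι_app_mem {U : X.Opens} (s : Γ(N.toModules, U)) : N.ι.app U s ∈ N.obj U := s.2

lemma ι_app_injective (U : X.Opens) : Function.Injective (N.ι.app U) :=
  fun _ _ h ↦ Subtype.ext h

lemma exists_ι_app_eq {U : X.Opens} {s : Γ(M, U)} (hs : s ∈ N.obj U) :
    ∃ t, N.ι.app U t = s := ⟨⟨s, hs⟩, rfl⟩

instance : Mono N.ι where
  right_cancellation f g h := by
    ext U x
    exact N.ι_app_injective U congr(($h).app U x)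

end LocalSubmodule

end Sections

section Sections

variable {X : Scheme.{u}} {M N : X.Modules}

/-- The kernel of a morphism, as a local family of submodules. -/
noncomputable def kerLocalSubmodule (φ : M ⟶ N) : LocalSubmodule M where
  obj U :=
    { carrier := {s | φ.app U s = 0}
      add_mem' := fun {a b} ha hb ↦ by
        simp only [Set.mem_ofPred_eq] at *
        rw [map_add, ha, hb, add_zero]
      zero_mem' := map_zero _
      smul_mem' := fun c s hs ↦ by
        simp only [Set.mem_ofPred_eq] at *
        rw [Scheme.Modules.Hom.app_smul, hs, smul_zero] }
  res_mem h s hs := by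
    change φ.app _ _ = 0
    rw [app_res, show φ.app _ s = 0 from hs, res_zero]
  mem_of_local {U s} hs := by
    refine eq_of_res_eq fun x hx ↦ ?_
    obtain ⟨V, hV, hxV, h⟩ := hs x hx
    refine ⟨V, hV, hxV, ?_⟩
    rw [← app_res, res_zero]
    exact h

/-- The image of a morphism, as a local family of submodules. -/
noncomputable def imageLocalSubmodule (φ : M ⟶ N) : LocalSubmodule N where
  obj U :=
    { carrier := {t | ∀ x ∈ U, ∃ (V : X.Opens) (h : V ≤ U), x ∈ V ∧ ∃ s, φ.app V s = res N h t}
      add_mem' := fun {a b} ha hb x hx ↦ by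
        obtain ⟨V, hV, hxV, s, hs⟩ := ha x hx
        obtain ⟨W, hW, hxW, t, ht⟩ := hb x hx
        refine ⟨V ⊓ W, inf_le_left.trans hV, ⟨hxV, hxW⟩,
          res M inf_le_left s + res M inf_le_right t, ?_⟩
        simp [hs, ht]
      zero_mem' := fun x hx ↦ ⟨U, le_rfl, hx, 0, by simp⟩
      smul_mem' := fun c t ht x hx ↦ by
        obtain ⟨V, hV, hxV, s, hs⟩ := ht x hx
        refine ⟨V, hV, hxV, X.presheaf.map (homOfLE hV).op c • s, ?_⟩
        rw [Scheme.Modules.Hom.app_smul, hs, res_smul] }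
  res_mem {U V} h t ht x hx := by
    obtain ⟨W, hW, hxW, s, hs⟩ := ht x (h hx)
    refine ⟨V ⊓ W, inf_le_left, ⟨hx, hxW⟩, res M inf_le_right s, ?_⟩
    simp [hs]
  mem_of_local {U t} ht x hx := by
    obtain ⟨V, hV, hxV, h⟩ := ht x hx
    obtain ⟨W, hW, hxW, s, hs⟩ := h x hxV
    exact ⟨W, hW.trans hV, hxW, s, by simp [hs]⟩

lemma app_injective (φ : M ⟶ N) [Mono φ] (U : X.Opens) : Function.Injective (φ.app U) := by
  refine (injective_iff_map_eq_zero (φ.app U).hom).mpr fun s hs ↦ ?_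
  obtain ⟨t, ht⟩ := (kerLocalSubmodule φ).exists_ι_app_eq (U := U) (s := s) hs
  have h : (kerLocalSubmodule φ).ι = 0 := by
    rw [← cancel_mono φ, zero_comp]
    ext U x
    exact (kerLocalSubmodule φ).ι_app_mem x
  rw [← ht, h]
  rfl

lemma exists_app_eq_res (φ : M ⟶ N) [Epi φ] {U : X.Opens} (t : Γ(N, U)) {x : X} (hx : x ∈ U) :
    ∃ (V : X.Opens) (h : V ≤ U), x ∈ V ∧ ∃ s, φ.app V s = res N h t := by
  have : Epi (imageLocalSubmodule φ).ι := by
    refine Preadditive.epi_of_cancel_zero _ fun {P} g hg ↦ ?_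
    rw [← cancel_epi φ, comp_zero]
    ext U s
    obtain ⟨t, ht⟩ := (imageLocalSubmodule φ).exists_ι_app_eq (U := U) (s := φ.app U s)
      (fun x hx ↦ ⟨U, le_rfl, hx, s, by simp⟩)
    change g.app U (φ.app U s) = 0
    rw [← ht]
    exact congr(($hg).app U t)
  have := isIso_of_mono_of_epi (imageLocalSubmodule φ).ι
  have h := (imageLocalSubmodule φ).ι_app_mem ((inv (imageLocalSubmodule φ).ι).app U t)
  have h' : (imageLocalSubmodule φ).ι.app U ((inv (imageLocalSubmodule φ).ι).app U t) = t :=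
    congr(($(IsIso.inv_hom_id (imageLocalSubmodule φ).ι)).app U t)
  rw [h'] at h
  exact h x hx

lemma exists_app_eq_of_exact {S : ShortComplex X.Modules} (hS : S.Exact) [Mono S.f] {U : X.Opens}
    {s : Γ(S.X₂, U)} (hs : S.g.app U s = 0) : ∃ t, S.f.app U t = s := by
  obtain ⟨t, ht⟩ := (kerLocalSubmodule S.g).exists_ι_app_eq (U := U) (s := s) hs
  have h : (kerLocalSubmodule S.g).ι ≫ S.g = 0 := by
    ext U x
    exact (kerLocalSubmodule S.g).ι_app_mem x
  refine ⟨(hS.lift _ h).app U t, ?_⟩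
  rw [← ht]
  exact congr(($(hS.lift_f _ h)).app U t)

@[simp] lemma g_app_f_app (S : ShortComplex X.Modules) {U : X.Opens} (s : Γ(S.X₁, U)) :
    S.g.app U (S.f.app U s) = 0 :=
  congr(($S.zero).app U s)

lemma IsFrame.restrict {n : ℕ} {U V : X.Opens} {e : Fin n → Γ(M, U)} (he : IsFrame M U e)
    (h : V ≤ U) : IsFrame M V fun i ↦ res M h (e i) := by
  intro W hW
  simpa using he W (hW.trans h)

/-- The basis of the module of sections given by a frame. -/
noncomputable def IsFrame.basis {n : ℕ} {U : X.Opens} {e : Fin n → Γ(M, U)} (he : IsFrame M U e) :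
    Module.Basis (Fin n) Γ(X, U) Γ(M, U) :=
  Module.Basis.mk (v := e)
    (by
      rw [Fintype.linearIndependent_iff]
      intro g hg
      have := (he U le_rfl).1 (a₁ := g) (a₂ := 0) (by simpa using hg)
      simpa using congrFun this)
    (by
      rintro s -
      obtain ⟨a, rfl⟩ := (he U le_rfl).2 s
      simp only [res_rfl]
      exact Submodule.sum_mem _ fun i _ ↦ Submodule.smul_mem _ _ (Submodule.subset_span ⟨i, rfl⟩))

@[simp] lemma IsFrame.basis_apply {n : ℕ} {U : X.Opens} {e : Fin n → Γ(M, U)} (he : IsFrame M U e)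
    (i : Fin n) : he.basis i = e i := by
  simp [IsFrame.basis]

lemma IsFrame.rank_eq {n m : ℕ} {U : X.Opens} [Nonempty U] {e : Fin n → Γ(M, U)}
    {f : Fin m → Γ(M, U)} (he : IsFrame M U e) (hf : IsFrame M U f) : n = m := by
  have := Scheme.component_nontrivial X U
  simpa using Fintype.card_congr (he.basis.indexEquiv hf.basis)

/-- A frame of the outer terms of a short exact sequence gives a frame of the middle term. -/
lemma IsFrame.append {S : ShortComplex X.Modules} (hS : S.ShortExact) {k q : ℕ} {U : X.Opens}
    {f : Fin k → Γ(S.X₁, U)} (hf : IsFrame S.X₁ U f) {e : Fin q → Γ(S.X₂, U)}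
    (he : IsFrame S.X₃ U fun i ↦ S.g.app U (e i)) :
    IsFrame S.X₂ U (Fin.append (fun i ↦ S.f.app U (f i)) e) := by
  have := hS.mono_f
  intro V hV
  constructor
  · intro a a' haa'
    simp only [Fin.sum_univ_add, Fin.append_left, Fin.append_right] at haa'
    have h2 : (fun j ↦ a (Fin.natAdd k j)) = fun j ↦ a' (Fin.natAdd k j) := by
      refine (he V hV).1 ?_
      have := congrArg (S.g.app V) haa'
      simpa [← app_res] using this
    have h1 : (fun j ↦ a (Fin.castAdd q j)) = fun j ↦ a' (Fin.castAdd q j) := by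
      refine (hf V hV).1 (app_injective S.f V ?_)
      have h2' : ∀ j, a (Fin.natAdd k j) = a' (Fin.natAdd k j) := congrFun h2
      simp only [h2', add_left_inj] at haa'
      simpa [← app_res] using haa'
    funext i
    induction i using Fin.addCases with
    | left i => exact congrFun h1 i
    | right i => exact congrFun h2 i
  · intro s
    obtain ⟨c, hc⟩ := (he V hV).2 (S.g.app V s)
    obtain ⟨t, ht⟩ := exists_app_eq_of_exact hS.exact (U := V)
      (s := s - ∑ j, c j • res S.X₂ hV (e j)) (by
        rw [map_sub, sub_eq_zero, ← hc]
        simp)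
    obtain ⟨b, hb⟩ := (hf V hV).2 t
    refine ⟨Fin.append b c, ?_⟩
    simp only [Fin.sum_univ_add, Fin.append_left, Fin.append_right]
    rw [← eq_sub_iff_add_eq, ← ht, ← hb]
    simp

/-- Around every point, a short exact sequence of vector bundles admits a frame of the middle term
adapted to the sequence. -/
lemma exists_adapted_frame {S : ShortComplex X.Modules} (hS : S.ShortExact) {k q : ℕ}
    (h₁ : IsVectorBundle k S.X₁) (h₃ : IsVectorBundle q S.X₃) (x : X) :
    ∃ U : X.Opens, x ∈ U ∧ ∃ (f : Fin k → Γ(S.X₁, U)) (e : Fin q → Γ(S.X₂, U)),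
      IsFrame S.X₁ U f ∧ IsFrame S.X₃ U fun i ↦ S.g.app U (e i) := by
  have := hS.epi_g
  obtain ⟨U, hxU, f, hf⟩ := h₁ x
  obtain ⟨V, hxV, g, hg⟩ := h₃ x
  choose W hW hxW e he using fun i ↦ exists_app_eq_res S.g (g i) hxV
  let W₀ : X.Opens := U ⊓ V ⊓ ⟨⋂ i, W i, isOpen_iInter_of_finite fun i ↦ (W i).isOpen⟩
  have hU : W₀ ≤ U := inf_le_left.trans inf_le_left
  have hV : W₀ ≤ V := inf_le_left.trans inf_le_right
  have hWi : ∀ i, W₀ ≤ W i := fun i x hx ↦ Set.mem_iInter.mp hx.2 i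
  refine ⟨W₀, ⟨⟨hxU, hxV⟩, Set.mem_iInter.mpr hxW⟩, fun i ↦ res _ hU (f i),
    fun i ↦ res _ (hWi i) (e i), hf.restrict hU, ?_⟩
  convert hg.restrict hV using 2 with i
  simp [he]

lemma IsVectorBundle.of_shortExact {S : ShortComplex X.Modules} (hS : S.ShortExact) {k q : ℕ}
    (h₁ : IsVectorBundle k S.X₁) (h₃ : IsVectorBundle q S.X₃) : IsVectorBundle (k + q) S.X₂ := by
  intro x
  obtain ⟨U, hx, f, e, hf, he⟩ := exists_adapted_frame hS h₁ h₃ x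
  exact ⟨U, hx, _, hf.append hS he⟩

lemma IsFrame.of_iso (φ : M ≅ N) {n : ℕ} {U : X.Opens} {e : Fin n → Γ(M, U)}
    (he : IsFrame M U e) : IsFrame N U fun i ↦ φ.hom.app U (e i) := by
  intro V hV
  have hb : Function.Bijective (φ.hom.app V) := by
    refine ⟨app_injective _ _, fun t ↦ ⟨φ.inv.app V t, congr(($(φ.inv_hom_id)).app V t)⟩⟩
  convert hb.comp (he V hV) using 1
  funext a
  simp

lemma IsVectorBundle.of_iso (φ : M ≅ N) {n : ℕ} (h : IsVectorBundle n M) : IsVectorBundle n N := by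
  intro x
  obtain ⟨U, hx, e, he⟩ := h x
  exact ⟨U, hx, _, he.of_iso φ⟩

end Sections

section Abelian

variable {C : Type*} [Category* C] [Abelian C] {X Y Z : C} (f : X ⟶ Y) (g : Y ⟶ Z)

lemma shortExact_cokernel_comp [Mono g] :
    (kernelCokernelCompSequence.snakeInput f g).L₃.ShortExact where
  exact := (kernelCokernelCompSequence.snakeInput f g).L₃_exact
  mono_f := (kernelCokernelCompSequence.snakeInput f g).L₂'_exact.mono_g
    (IsZero.eq_zero_of_src (isZero_kernel_of_mono g) _)
  epi_g := by
    have : Epi (kernelCokernelCompSequence.snakeInput f g).L₂.g :=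
      inferInstanceAs (Epi (biprod.snd : Y ⊞ Z ⟶ Z))
    infer_instance

lemma shortExact_kernel_comp [Epi f] :
    (kernelCokernelCompSequence.snakeInput f g).L₀.ShortExact where
  exact := (kernelCokernelCompSequence.snakeInput f g).L₀_exact
  mono_f := by
    have : Mono (kernelCokernelCompSequence.snakeInput f g).L₁.f :=
      inferInstanceAs (Mono (biprod.inl : X ⟶ X ⊞ Y))
    infer_instance
  epi_g := (kernelCokernelCompSequence.snakeInput f g).L₁'_exact.epi_f
    (IsZero.eq_zero_of_tgt (isZero_cokernel_of_epi f) _)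

/-- The extension of `G` by `F` given by the preimage of a subobject `j : G ⟶ E/F` in `E`. -/
noncomputable def preimageShortComplex {E F G : C} (i : F ⟶ E) (j : G ⟶ cokernel i) [Mono j] :
    ShortComplex C where
  X₁ := F
  X₂ := kernel (cokernel.π i ≫ cokernel.π j)
  X₃ := G
  f := kernel.lift _ i (by simp)
  g := kernel.map (cokernel.π i ≫ cokernel.π j) (cokernel.π j) (cokernel.π i) (𝟙 _) (by simp) ≫
    (asIso (Abelian.factorThruImage j)).inv
  zero := by
    rw [← cancel_mono (asIso (Abelian.factorThruImage j)).hom, ← cancel_mono (Abelian.image.ι j)]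
    simp

lemma preimageShortComplex_shortExact {E F G : C} (i : F ⟶ E) [Mono i] (j : G ⟶ cokernel i)
    [Mono j] : (preimageShortComplex i j).ShortExact := by
  let e₁ : F ≅ Abelian.image i := asIso (Abelian.factorThruImage i)
  let e₃ : G ≅ Abelian.image j := asIso (Abelian.factorThruImage j)
  let e : preimageShortComplex i j ≅
      (kernelCokernelCompSequence.snakeInput (cokernel.π i) (cokernel.π j)).L₀ :=
    ShortComplex.isoMk e₁ (Iso.refl _) e₃ ?_ ?_
  · exact ShortComplex.shortExact_of_iso e.symm
      (shortExact_kernel_comp (cokernel.π i) (cokernel.π j))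
  · change e₁.hom ≫ kernel.map (cokernel.π i) (cokernel.π i ≫ cokernel.π j) (𝟙 _) (cokernel.π j)
      (by simp) = kernel.lift _ i (by simp) ≫ 𝟙 _
    rw [← cancel_mono (kernel.ι _)]
    simp [e₁]
  · change 𝟙 _ ≫ kernel.map (cokernel.π i ≫ cokernel.π j) (cokernel.π j) (cokernel.π i) (𝟙 _)
      (by simp) = (kernel.map (cokernel.π i ≫ cokernel.π j) (cokernel.π j) (cokernel.π i) (𝟙 _)
      (by simp) ≫ e₃.inv) ≫ e₃.hom
    simp

/-- The inclusion of the preimage of a subobject of `E / F` in `E`. -/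
noncomputable def preimageι {E F G : C} (i : F ⟶ E) (j : G ⟶ cokernel i) [Mono j] :
    (preimageShortComplex i j).X₂ ⟶ E :=
  kernel.ι (cokernel.π i ≫ cokernel.π j)

instance {E F G : C} (i : F ⟶ E) (j : G ⟶ cokernel i) [Mono j] : Mono (preimageι i j) :=
  inferInstanceAs (Mono (kernel.ι _))

/-- The quotient by the preimage of a subobject `G` of `E / F` is the quotient of `E / F` by `G`. -/
noncomputable def cokernelPreimageιIso {E F G : C} (i : F ⟶ E) (j : G ⟶ cokernel i) [Mono j] :
    cokernel (preimageι i j) ≅ cokernel j :=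
  haveI : Epi (cokernel.π i ≫ cokernel.π j) := epi_comp _ _
  @asIso _ _ _ _ _ (Abelian.isIso_factorThruCoimage (cokernel.π i ≫ cokernel.π j))

end Abelian

variable {X : Scheme.{u}} {E : X.Modules} {k ν : ℕ}

/-- A subbundle of a subbundle is a subbundle. -/
noncomputable def Subbundle.trans (F : Subbundle E k) (G : Subbundle F.obj ν) : Subbundle E ν where
  obj := G.obj
  ι := G.ι ≫ F.ι
  mono := by
    have := F.mono
    have := G.mono
    infer_instance
  isVectorBundle := G.isVectorBundle
  exists_isVectorBundle_cokernel := by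
    have := F.mono
    obtain ⟨p, hp⟩ := F.exists_isVectorBundle_cokernel
    obtain ⟨q, hq⟩ := G.exists_isVectorBundle_cokernel
    exact ⟨q + p, IsVectorBundle.of_shortExact (shortExact_cokernel_comp G.ι F.ι) hq hp⟩

/-- The inclusion of a subbundle of `E / F`, with target the cokernel of `F ⟶ E`. -/
noncomputable def quotientι {F : Subbundle E k} (G : Subbundle F.quotient ν) :
    G.obj ⟶ cokernel F.ι := G.ι

instance {F : Subbundle E k} (G : Subbundle F.quotient ν) : Mono (quotientι G) := G.mono

/-- The short exact sequence expressing the preimage in `E` of a subbundle `G` of `E / F` as an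
extension of `G` by `F`. -/
noncomputable def Subbundle.extension (F : Subbundle E k) (G : Subbundle F.quotient ν) :
    ShortComplex X.Modules :=
  preimageShortComplex F.ι (quotientι G)

lemma Subbundle.extension_shortExact (F : Subbundle E k) (G : Subbundle F.quotient ν) :
    (F.extension G).ShortExact :=
  haveI := F.mono
  preimageShortComplex_shortExact F.ι (quotientι G)

/-- The preimage in `E` of a subbundle of `E / F`. -/
noncomputable def Subbundle.preimage (F : Subbundle E k) (G : Subbundle F.quotient ν) :
    Subbundle E (k + ν) where
  obj := (F.extension G).X₂
  ι := preimageι F.ι (quotientι G)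
  mono := inferInstanceAs (Mono (preimageι F.ι (quotientι G)))
  isVectorBundle :=
    IsVectorBundle.of_shortExact (S := F.extension G) (F.extension_shortExact G)
      F.isVectorBundle G.isVectorBundle
  exists_isVectorBundle_cokernel := by
    obtain ⟨q, hq⟩ := G.exists_isVectorBundle_cokernel
    exact ⟨q, IsVectorBundle.of_iso (cokernelPreimageιIso F.ι (quotientι G)).symm hq⟩

section LocalRing

open IsLocalRing TensorProduct KaehlerDifferential

variable {B A R : Type*} [CommRing B] [CommRing A] [CommRing R] [Algebra B A] [Algebra A R]
  [Algebra B R] [IsScalarTower B A R]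

/-- A local ring of a standard smooth algebra of relative dimension one, with residue field equal to
the base, is a principal ideal ring. -/
lemma isPrincipalIdealRing_of_isStandardSmooth [Algebra.IsStandardSmoothOfRelativeDimension 1 B A]
    (p : Ideal A) [p.IsPrime] [IsLocalization.AtPrime R p] [IsLocalRing R] [IsNoetherianRing R]
    [IsDomain R] (h : Function.Bijective (algebraMap B (ResidueField R))) :
    IsPrincipalIdealRing R := by
  have : Nontrivial A := ⟨0, 1, fun h ↦ Ideal.IsPrime.ne_top ‹p.IsPrime›
    ((Ideal.eq_top_iff_one p).mpr (h ▸ p.zero_mem))⟩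
  have : Algebra.IsStandardSmooth B A :=
    Algebra.IsStandardSmoothOfRelativeDimension.isStandardSmooth 1
  have : Algebra.FormallyEtale A R := Algebra.FormallyEtale.of_isLocalization p.primeCompl
  have : Algebra.FormallySmooth B R := Algebra.FormallySmooth.comp B A R
  have : Algebra.FormallySmooth B (ResidueField R) :=
    Algebra.FormallySmooth.of_equiv (AlgEquiv.ofBijective (Algebra.ofId B (ResidueField R)) h)
  have hs : Function.Surjective (algebraMap R (ResidueField R)) := IsLocalRing.residue_surjective
  have hinj := (Algebra.FormallySmooth.kerCotangentToTensor_injective_iff (R := B) hs).mpr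
    inferInstance
  have hrank : Module.rank A Ω[A⁄B] = 1 := by
    exact_mod_cast
      Algebra.IsStandardSmoothOfRelativeDimension.rank_kaehlerDifferential (R := B) (S := A) 1
  have hrank' : Module.finrank (ResidueField R) (ResidueField R ⊗[R] Ω[R⁄B]) = 1 := by
    have e := tensorKaehlerEquivOfFormallyEtale B A R
    have : Module.Free R Ω[R⁄B] := Module.Free.of_equiv e
    rw [Module.finrank_baseChange, ← e.finrank_eq, Module.finrank_baseChange]
    simp [Module.finrank, hrank]
  refine ((tfae_of_isNoetherianRing_of_isLocalRing_of_isDomain R).out 5 0).mp ?_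
  rw [← hrank']
  have hk : ∀ I : Ideal R, I = RingHom.ker (algebraMap R (ResidueField R)) →
      ∃ φ : I.Cotangent →ₗ[R] ResidueField R ⊗[R] Ω[R⁄B], Function.Injective φ := by
    rintro _ rfl
    exact ⟨_, hinj⟩
  obtain ⟨φ, hφ⟩ := hk (maximalIdeal R) ker_residue.symm
  have := Module.finite_of_finrank_pos (hrank' ▸ zero_lt_one)
  let ψ : CotangentSpace R →ₗ[ResidueField R] ResidueField R ⊗[R] Ω[R⁄B] :=
    LinearMap.extendScalarsOfSurjective hs φ
  exact LinearMap.finrank_le_finrank_of_injective (f := ψ) hφ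

end LocalRing

section Curve

variable {K : Type u} [Field K] [IsAlgClosed K] (C : SmoothProjectiveCurve K)

/-- The structure morphism `K → Γ(C, 𝒪_C)`. -/
noncomputable def constants : K →+* Γ(C.X, ⊤) :=
  ((Scheme.ΓSpecIso (.of K)).inv ≫ C.hom.appTop).hom

lemma residue_germ_constants_bijective {x : C.X} (hx : IsClosed {x}) :
    Function.Bijective ((IsLocalRing.residue (C.X.presheaf.stalk x)).comp
      ((C.X.presheaf.germ ⊤ x trivial).hom.comp (constants C))) := by
  have h := (ConcreteCategory.isIso_iff_bijective (residueFieldIsoBase C.hom x hx).inv).mp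
    inferInstance
  have hC : C.hom = C.X.toSpecΓ ≫ Spec.map ((Scheme.ΓSpecIso (.of K)).inv ≫ C.hom.appTop) := by
    rw [Spec.map_comp, ← Scheme.toSpecΓ_naturality_assoc]
    simp
  have h1 : (residueFieldIsoBase C.hom x hx).inv = ((Scheme.ΓSpecIso (.of K)).inv ≫ C.hom.appTop) ≫
      C.X.presheaf.germ ⊤ x trivial ≫ C.X.residue x := by
    apply Spec.map_injective
    rw [SpecMap_residueFieldIsoBase_inv, Spec.map_comp, Spec.map_comp, Category.assoc,
      ← Scheme.fromSpecStalk_toSpecΓ]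
    conv_lhs => rw [hC]
    rfl
  rw [h1] at h
  exact h

lemma isPrincipalIdealRing_stalk_of_isClosed {x : C.X} (hx : IsClosed {x}) :
    IsPrincipalIdealRing (C.X.presheaf.stalk x) := by
  obtain ⟨U, hU, V, hV, hxV, e, h⟩ :=
    SmoothOfRelativeDimension.exists_isStandardSmoothOfRelativeDimension (n := 1) (f := C.hom) x
  have : U = ⊤ := by
    refine top_unique fun y _ ↦ ?_
    rw [Subsingleton.elim y (C.hom x)]
    exact e hxV
  subst this
  algebraize [(C.hom.appLE ⊤ V e).hom, (C.X.presheaf.germ V x hxV).hom, ((C.X.presheaf.germ V x hxV).hom.comp (C.hom.appLE ⊤ V e).hom)]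
  have := hV.isLocalization_stalk ⟨x, hxV⟩
  refine isPrincipalIdealRing_of_isStandardSmooth (B := Γ(Spec (.of K), ⊤)) (A := Γ(C.X, V))
    (hV.primeIdealOf ⟨x, hxV⟩).asIdeal ?_
  have hb := (residue_germ_constants_bijective C hx).comp (ConcreteCategory.bijective_of_isIso (Scheme.ΓSpecIso (.of K)).hom)
  convert! hb using 1
  funext a
  change C.X.residue x (C.X.presheaf.germ V x hxV (C.hom.appLE ⊤ V e a)) =
    C.X.residue x (C.X.presheaf.germ ⊤ x trivial (C.hom.appTop
      ((Scheme.ΓSpecIso (.of K)).inv ((Scheme.ΓSpecIso (.of K)).hom a))))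
  rw [Scheme.Hom.appLE, Iso.hom_inv_id_apply, CommRingCat.comp_apply,
    TopCat.Presheaf.germ_res_apply]
  rfl

instance : CompactSpace C.X :=
  (quasiCompact_iff_compactSpace C.hom).mp inferInstance

lemma isClosed_of_ne_genericPoint {x : C.X} (hx : x ≠ genericPoint C.X) : IsClosed {x} := by
  obtain ⟨y, hxy, hy⟩ : ∃ y, x ⤳ y ∧ IsClosed {y} := by
    obtain ⟨y, hy, hy'⟩ := isClosed_closure.exists_closed_singleton (S := closure {x})
      ⟨x, subset_closure rfl⟩
    exact ⟨y, specializes_iff_mem_closure.mpr hy, hy'⟩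
  have := isPrincipalIdealRing_stalk_of_isClosed C hy
  have hr := C.X.range_fromSpecStalk (x := y)
  obtain ⟨p, rfl⟩ := hr.ge hxy
  by_cases hp : p.asIdeal = ⊥
  · obtain ⟨q, hq⟩ := hr.ge (genericPoint_specializes y)
    refine absurd (Specializes.antisymm ?_ (genericPoint_specializes _)).eq hx
    rw [← hq]
    exact ((PrimeSpectrum.le_iff_specializes p q).mp (by
      change p.asIdeal ≤ q.asIdeal
      rw [hp]
      exact bot_le)).map
        (C.X.fromSpecStalk y).continuous
  · have : p = IsLocalRing.closedPoint _ := PrimeSpectrum.ext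
      (IsLocalRing.eq_maximalIdeal (p.isPrime.isMaximal hp))
    rw [this, Scheme.fromSpecStalk_closedPoint]
    exact hy

lemma isDiscreteValuationRing_stalk {x : C.X} (hx : x ≠ genericPoint C.X) :
    IsDiscreteValuationRing (C.X.presheaf.stalk x) := by
  have := isPrincipalIdealRing_stalk_of_isClosed C (isClosed_of_ne_genericPoint C hx)
  refine ⟨fun h ↦ hx ?_⟩
  obtain ⟨q, hq⟩ := (C.X.range_fromSpecStalk (x := x)).ge (genericPoint_specializes x)
  have : q = IsLocalRing.closedPoint _ := by
    by_cases hp : q.asIdeal = ⊥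
    · exact PrimeSpectrum.ext (hp.trans h.symm)
    · exact PrimeSpectrum.ext (IsLocalRing.eq_maximalIdeal (q.isPrime.isMaximal hp))
  rw [← hq, this, Scheme.fromSpecStalk_closedPoint]

lemma coheight_eq_one {x : C.X} (hx : x ≠ genericPoint C.X) : Order.coheight x = 1 := by
  have := isDiscreteValuationRing_stalk C hx
  have h := IsDiscreteValuationRing.ringKrullDim_eq_one (C.X.presheaf.stalk x)
  rw [ringKrullDim_stalk_eq_coheight] at h
  exact_mod_cast h

lemma coheight_genericPoint (X : Scheme.{u}) [IsIntegral X] :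
    Order.coheight (genericPoint X) = 0 := by
  have h : ringKrullDim X.functionField = 0 := ringKrullDim_eq_zero_of_field X.functionField
  rw [ringKrullDim_stalk_eq_coheight] at h
  exact_mod_cast h

instance (x : C.X) : IsPrincipalIdealRing (C.X.presheaf.stalk x) := by
  by_cases hx : x = genericPoint C.X
  · subst hx
    exact inferInstanceAs (IsPrincipalIdealRing C.X.functionField)
  · have := isDiscreteValuationRing_stalk C hx
    infer_instance

end Curve

end CurveBundle

namespace CurveBundle

/-- The places of a function field of one variable `L` with algebraically closed field of constants
`K`, given by their normalized order functions (whose value at `0` is irrelevant). -/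
structure PlaceSystem (K L P : Type*) [Field K] [Field L] [Algebra K L] where
  ord : P → L → ℤ
  ord_mul (p : P) {f g : L} : f ≠ 0 → g ≠ 0 → ord p (f * g) = ord p f + ord p g
  min_le_ord_add (p : P) {f g : L} : f + g ≠ 0 → f ≠ 0 → g ≠ 0 →
    min (ord p f) (ord p g) ≤ ord p (f + g)
  exists_ord_eq_one (p : P) : ∃ t, t ≠ 0 ∧ ord p t = 1
  ord_algebraMap (p : P) {c : K} : c ≠ 0 → ord p (algebraMap K L c) = 0
  exists_const (p : P) {f : L} : f ≠ 0 → 0 ≤ ord p f →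
    ∃ c : K, f - algebraMap K L c = 0 ∨ 0 < ord p (f - algebraMap K L c)
  finite_support {f : L} : f ≠ 0 → {p | ord p f ≠ 0}.Finite
  exists_eq_const {f : L} : f ≠ 0 → (∀ p, 0 ≤ ord p f) → ∃ c : K, algebraMap K L c = f
  exists_pole {p q : P} : p ≠ q → ∃ f, f ≠ 0 ∧ ord p f < 0 ∧ 0 ≤ ord q f

namespace PlaceSystem

variable {K L P : Type*} [Field K] [Field L] [Algebra K L] (S : PlaceSystem K L P)

@[simp] lemma ord_one (p : P) : S.ord p 1 = 0 := by
  simpa using S.ord_algebraMap p (one_ne_zero (α := K))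

lemma ord_inv (p : P) {f : L} (hf : f ≠ 0) : S.ord p f⁻¹ = -S.ord p f := by
  have := S.ord_mul p hf (inv_ne_zero hf)
  rw [mul_inv_cancel₀ hf, ord_one] at this
  omega

lemma ord_div (p : P) {f g : L} (hf : f ≠ 0) (hg : g ≠ 0) :
    S.ord p (f / g) = S.ord p f - S.ord p g := by
  rw [div_eq_mul_inv, S.ord_mul p hf (inv_ne_zero hg), S.ord_inv p hg, sub_eq_add_neg]

lemma ord_pow (p : P) {f : L} (hf : f ≠ 0) (n : ℕ) : S.ord p (f ^ n) = n * S.ord p f := by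
  induction n with
  | zero => simp
  | succ n ih =>
    rw [pow_succ, S.ord_mul p (pow_ne_zero n hf) hf, ih]
    push_cast
    ring

lemma ord_zpow (p : P) {f : L} (hf : f ≠ 0) (n : ℤ) : S.ord p (f ^ n) = n * S.ord p f := by
  obtain ⟨n, rfl | rfl⟩ := n.eq_nat_or_neg
  · simp [S.ord_pow p hf]
  · simp [S.ord_inv p (pow_ne_zero n hf), S.ord_pow p hf]

/-- The `K`-subspace of functions with order at least `n` at `p`. -/
def leOrd (p : P) (n : ℤ) : Submodule K L where
  carrier := {f | f ≠ 0 → n ≤ S.ord p f}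
  zero_mem' h := absurd rfl h
  add_mem' {f g} hf hg h := by
    by_cases hf0 : f = 0
    · subst hf0
      rw [zero_add] at h ⊢
      exact hg h
    by_cases hg0 : g = 0
    · subst hg0
      rw [add_zero] at h ⊢
      exact hf h
    exact (le_min (hf hf0) (hg hg0)).trans (S.min_le_ord_add p h hf0 hg0)
  smul_mem' c f hf h := by
    rw [Algebra.smul_def] at h ⊢
    have hc : c ≠ 0 := fun hc ↦ h (by simp [hc])
    have hf0 : f ≠ 0 := right_ne_zero_of_mul h
    rw [S.ord_mul p (left_ne_zero_of_mul h) hf0, S.ord_algebraMap p hc, zero_add]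
    exact hf hf0

lemma mem_leOrd {p : P} {n : ℤ} {f : L} : f ∈ S.leOrd p n ↔ (f ≠ 0 → n ≤ S.ord p f) := Iff.rfl

lemma mem_leOrd_of_ne_zero {p : P} {n : ℤ} {f : L} (hf : f ≠ 0) :
    f ∈ S.leOrd p n ↔ n ≤ S.ord p f := by
  simp [mem_leOrd, hf]

lemma ord_add_eq_left {p : P} {f g : L} (hf : f ≠ 0) (hg : g ∈ S.leOrd p (S.ord p f + 1)) :
    f + g ≠ 0 ∧ S.ord p (f + g) = S.ord p f := by
  have h : ∀ g ∈ S.leOrd p (S.ord p f + 1), f + g ≠ 0 := by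
    intro g hg h
    rw [eq_neg_of_add_eq_zero_right h, neg_mem_iff, S.mem_leOrd_of_ne_zero hf] at hg
    omega
  refine ⟨h g hg, le_antisymm ?_ ?_⟩
  · by_contra! hlt
    have h1 : f + g ∈ S.leOrd p (S.ord p f + 1) := fun _ ↦ by omega
    have h2 : f ∈ S.leOrd p (S.ord p f + 1) := by simpa using sub_mem h1 hg
    have := h2 hf
    omega
  · refine (S.mem_leOrd_of_ne_zero (h g hg)).mp (add_mem (fun _ ↦ le_rfl) fun h ↦ ?_)
    have := hg h
    omega

lemma exists_neg_pos {p q : P} (h : p ≠ q) : ∃ f, f ≠ 0 ∧ S.ord p f < 0 ∧ 0 < S.ord q f := by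
  obtain ⟨f, hf, hfp, hfq⟩ := S.exists_pole h
  obtain ⟨g, hg, hgq, hgp⟩ := S.exists_pole h.symm
  refine ⟨f / g, div_ne_zero hf hg, ?_, ?_⟩ <;> rw [S.ord_div _ hf hg] <;> omega

lemma one_add_ne_zero_of_ord_neg {p : P} {x : L} (hx : x ≠ 0) (h : S.ord p x < 0) :
    1 + x ≠ 0 ∧ S.ord p (1 + x) = S.ord p x := by
  rw [add_comm]
  exact S.ord_add_eq_left hx ((S.mem_leOrd_of_ne_zero one_ne_zero).mpr (by simp; omega))

lemma ord_one_add_of_ord_pos {p : P} {x : L} (hx : x ≠ 0) (h : 0 < S.ord p x) :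
    S.ord p (1 + x) = 0 := by
  rw [← S.ord_one p]
  exact (S.ord_add_eq_left one_ne_zero
    ((S.mem_leOrd_of_ne_zero hx).mpr (by simp; omega))).2

lemma exists_neg_forall_pos (p : P) (T : Finset P) (hp : p ∉ T) :
    ∃ f, f ≠ 0 ∧ S.ord p f < 0 ∧ ∀ q ∈ T, 0 < S.ord q f := by
  classical
  induction T using Finset.induction_on with
  | empty =>
    obtain ⟨t, ht, ht1⟩ := S.exists_ord_eq_one p
    exact ⟨t⁻¹, inv_ne_zero ht, by rw [S.ord_inv p ht]; omega, by simp⟩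
  | insert q T hq ih =>
    simp only [Finset.mem_insert, not_or] at hp
    obtain ⟨x, hx, hxp, hxT⟩ := ih hp.2
    obtain ⟨y, hy, hyp, hyq⟩ := S.exists_neg_pos hp.1
    obtain ⟨n, hn, hn'⟩ : ∃ n : ℕ, 0 < n ∧ ∀ r ∈ T, -S.ord r y < n := by
      refine ⟨∑ r ∈ T, (S.ord r y).natAbs + 1, by omega, fun r hr ↦ ?_⟩
      have := Finset.single_le_sum (f := fun r ↦ (S.ord r y).natAbs) (fun _ _ ↦ Nat.zero_le _) hr
      omega
    have hxn := pow_ne_zero n hx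
    have key : ∀ r ∈ T, 0 < S.ord r (x ^ n) + S.ord r y := by
      intro r hr
      have h1 := hn' r hr
      have h2 : (n : ℤ) ≤ n * S.ord r x := le_mul_of_one_le_right (by omega) (hxT r hr)
      rw [S.ord_pow r hx]
      omega
    have neg : ∀ r, S.ord r x < 0 → S.ord r (x ^ n) < 0 := by
      intro r hr
      rw [S.ord_pow r hx]
      exact mul_neg_of_pos_of_neg (by exact_mod_cast hn) hr
    rcases lt_trichotomy (S.ord q x) 0 with h | h | h
    · obtain ⟨h0, h0p⟩ := S.one_add_ne_zero_of_ord_neg hxn (neg p hxp)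
      refine ⟨x ^ n / (1 + x ^ n) * y, mul_ne_zero (div_ne_zero hxn h0) hy, ?_, ?_⟩
      · rw [S.ord_mul p (div_ne_zero hxn h0) hy, S.ord_div p hxn h0, h0p]
        omega
      · intro r hr
        rw [S.ord_mul r (div_ne_zero hxn h0) hy, S.ord_div r hxn h0]
        rcases Finset.mem_insert.mp hr with rfl | hr
        · rw [(S.one_add_ne_zero_of_ord_neg hxn (neg r h)).2]
          omega
        · have hpos : 0 < S.ord r (x ^ n) := by
            rw [S.ord_pow r hx]
            exact mul_pos (by exact_mod_cast hn) (hxT r hr)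
          have := key r hr
          rw [S.ord_one_add_of_ord_pos hxn hpos]
          omega
    · refine ⟨x ^ n * y, mul_ne_zero hxn hy, ?_, ?_⟩
      · have := neg p hxp
        rw [S.ord_mul p hxn hy]
        omega
      · intro r hr
        rw [S.ord_mul r hxn hy]
        rcases Finset.mem_insert.mp hr with rfl | hr
        · rw [S.ord_pow r hx, h]
          omega
        · exact key r hr
    · exact ⟨x, hx, hxp, by simpa [h] using hxT⟩

/-- Weak approximation: there are functions with prescribed order at one place, which vanish to high
order at finitely many other places. -/
lemma exists_ord_eq_forall_le (p : P) (T : Finset P) (hp : p ∉ T) (a N : ℤ) :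
    ∃ f, f ≠ 0 ∧ S.ord p f = a ∧ ∀ q ∈ T, N ≤ S.ord q f := by
  obtain ⟨x, hx, hxp, hxT⟩ := S.exists_neg_forall_pos p T hp
  obtain ⟨t, ht, htp⟩ := S.exists_ord_eq_one p
  obtain ⟨n, hn, hn'⟩ : ∃ n : ℕ, 0 < n ∧ ∀ r ∈ T, N - a * S.ord r t ≤ n := by
    refine ⟨∑ r ∈ T, (N - a * S.ord r t).natAbs + 1, by omega, fun r hr ↦ ?_⟩
    have := Finset.single_le_sum (f := fun r ↦ (N - a * S.ord r t).natAbs)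
      (fun _ _ ↦ Nat.zero_le _) hr
    omega
  have hxn := pow_ne_zero n hx
  have hta := zpow_ne_zero a ht
  have hneg : S.ord p (x ^ n) < 0 := by
    rw [S.ord_pow p hx]
    exact mul_neg_of_pos_of_neg (by exact_mod_cast hn) hxp
  obtain ⟨h0, h0p⟩ := S.one_add_ne_zero_of_ord_neg hxn hneg
  refine ⟨x ^ n / (1 + x ^ n) * t ^ a, mul_ne_zero (div_ne_zero hxn h0) hta, ?_, ?_⟩
  · rw [S.ord_mul p (div_ne_zero hxn h0) hta, S.ord_div p hxn h0, h0p, S.ord_zpow p ht, htp]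
    omega
  · intro r hr
    have h1 := hn' r hr
    have h2 : (n : ℤ) ≤ S.ord r (x ^ n) := by
      rw [S.ord_pow r hx]
      exact le_mul_of_one_le_right (by omega) (hxT r hr)
    rw [S.ord_mul r (div_ne_zero hxn h0) hta, S.ord_div r hxn h0,
      S.ord_one_add_of_ord_pos hxn (by omega), S.ord_zpow r ht]
    omega

variable {K L P : Type*} [Field K] [Field L] [Algebra K L] (S : PlaceSystem K L P)

open Classical in
/-- The Riemann-Roch space of an effective divisor. -/
noncomputable def rrSpace (D : Multiset P) : Submodule K L :=
  ⨅ p, S.leOrd p (-(D.count p : ℤ))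

open Classical in
lemma mem_rrSpace {D : Multiset P} {f : L} (hf : f ≠ 0) :
    f ∈ S.rrSpace D ↔ ∀ p, -(D.count p : ℤ) ≤ S.ord p f := by
  simp [rrSpace, Submodule.mem_iInf, S.mem_leOrd_of_ne_zero hf]

lemma finrank_rrSpace_le (D : Multiset P) :
    FiniteDimensional K (S.rrSpace D) ∧ Module.finrank K (S.rrSpace D) ≤ D.card + 1 := by
  classical
  have step : ∀ (V W : Submodule K L) (n : ℕ) (x : L), FiniteDimensional K V →
      Module.finrank K V ≤ n → W ≤ V ⊔ K ∙ x →
      FiniteDimensional K W ∧ Module.finrank K W ≤ n + 1 := by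
    intro V W n x _ hn hW
    refine ⟨Submodule.finiteDimensional_of_le hW, (Submodule.finrank_mono hW).trans ?_⟩
    refine (Submodule.finrank_add_le_finrank_add_finrank _ _).trans (add_le_add hn ?_)
    exact (finrank_span_le_card ({x} : Set L)).trans (by simp)
  induction D using Multiset.induction_on with
  | empty =>
    refine step ⊥ _ 0 1 inferInstance (by simp) fun f hf ↦ ?_
    by_cases hf0 : f = 0
    · simp [hf0]
    obtain ⟨c, rfl⟩ := S.exists_eq_const hf0 (by simpa using (S.mem_rrSpace hf0).mp hf)
    rw [bot_sup_eq, Algebra.algebraMap_eq_smul_one]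
    exact Submodule.smul_mem _ _ (Submodule.mem_span_singleton_self _)
  | cons p D ih =>
    rw [Multiset.card_cons]
    by_cases hD : S.rrSpace (p ::ₘ D) ≤ S.rrSpace D
    · exact step _ _ _ 0 ih.1 ih.2 (hD.trans le_sup_left)
    obtain ⟨x, hx, hxD⟩ := SetLike.not_le_iff_exists.mp hD
    have hx0 : x ≠ 0 := fun h ↦ hxD (h ▸ zero_mem _)
    have hx' := (S.mem_rrSpace hx0).mp hx
    rw [S.mem_rrSpace hx0] at hxD
    push Not at hxD
    have hoff : ∀ q, q ≠ p → (p ::ₘ D).count q = D.count q := fun q hq ↦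
      Multiset.count_cons_of_ne hq D
    have hp : S.ord p x = -(D.count p : ℤ) - 1 := by
      obtain ⟨q, hq⟩ := hxD
      have h1 := hx' q
      by_cases hqp : q = p
      · subst hqp
        rw [Multiset.count_cons_self] at h1
        push_cast at h1
        omega
      · rw [hoff q hqp] at h1
        omega
    refine step _ _ _ x ih.1 ih.2 fun f hf ↦ ?_
    by_cases hf0 : f = 0
    · simp [hf0]
    have hf' := (S.mem_rrSpace hf0).mp hf
    have hfp := hf' p
    rw [Multiset.count_cons_self] at hfp
    push_cast at hfp
    obtain ⟨c, hc⟩ := S.exists_const p (div_ne_zero hf0 hx0) (by rw [S.ord_div p hf0 hx0]; omega)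
    have hfx : f = (f - c • x) + c • x := by ring
    rw [hfx]
    refine Submodule.add_mem_sup ?_ (Submodule.smul_mem _ _ (Submodule.mem_span_singleton_self _))
    by_cases h0 : f - c • x = 0
    · rw [h0]; exact zero_mem _
    have hmem : f - c • x ∈ S.rrSpace (p ::ₘ D) := sub_mem hf (Submodule.smul_mem _ _ hx)
    rw [S.mem_rrSpace h0] at hmem ⊢
    intro q
    by_cases hqp : q = p
    · subst hqp
      have hdiv : f - c • x = (f / x - algebraMap K L c) * x := by
        rw [sub_mul, div_mul_cancel₀ _ hx0, Algebra.smul_def]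
      have hne : f / x - algebraMap K L c ≠ 0 := fun h ↦ h0 (by rw [hdiv, h, zero_mul])
      rw [hdiv, S.ord_mul q hne hx0, hp]
      have := hc.resolve_left hne
      omega
    · rw [← hoff q hqp]
      exact hmem q

/-- The divisor of poles of a function. -/
noncomputable def poleDivisor {f : L} (hf : f ≠ 0) : Multiset P :=
  ∑ p ∈ (S.finite_support hf).toFinset, Multiset.replicate (-S.ord p f).toNat p

open Classical in
lemma count_poleDivisor {f : L} (hf : f ≠ 0) (p : P) :
    (S.poleDivisor hf).count p = (-S.ord p f).toNat := by
  rw [poleDivisor, Multiset.count_sum']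
  simp only [Multiset.count_replicate]
  rw [Finset.sum_ite_eq' _ p]
  by_cases h : S.ord p f = 0 <;> simp [h]

lemma card_poleDivisor {f : L} (hf : f ≠ 0) :
    (S.poleDivisor hf).card = ∑ p ∈ (S.finite_support hf).toFinset, (-S.ord p f).toNat := by
  simp [poleDivisor]

lemma card_le_card_poleDivisor {g : L} (hg : g ≠ 0) {J : Type*} [Fintype J] {u : J → L}
    (hu : LinearIndependent K fun i : ℕ × J ↦ g ^ i.1 * u i.2) :
    Fintype.card J ≤ (S.poleDivisor hg).card := by
  classical
  have hu0 : ∀ j, u j ≠ 0 := fun j ↦ by simpa using hu.ne_zero (0, j)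
  let C : Multiset P := ∑ j, S.poleDivisor (hu0 j)
  have hC : ∀ j p, -(C.count p : ℤ) ≤ S.ord p (u j) := by
    intro j p
    have h1 : (-S.ord p (u j)).toNat ≤ C.count p := by
      rw [Multiset.count_sum', ← S.count_poleDivisor (hu0 j)]
      exact Finset.single_le_sum (f := fun j ↦ (S.poleDivisor (hu0 j)).count p)
        (fun _ _ ↦ Nat.zero_le _) (Finset.mem_univ j)
    omega
  have bound : ∀ l : ℕ, (l + 1) * Fintype.card J ≤ l * (S.poleDivisor hg).card + C.card + 1 := by
    intro l
    obtain ⟨_, hfin⟩ := S.finrank_rrSpace_le (l • S.poleDivisor hg + C)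
    have hmem : ∀ i : Fin (l + 1) × J,
        g ^ (i.1 : ℕ) * u i.2 ∈ S.rrSpace (l • S.poleDivisor hg + C) := by
      intro i
      rw [S.mem_rrSpace (mul_ne_zero (pow_ne_zero _ hg) (hu0 _))]
      intro p
      rw [S.ord_mul p (pow_ne_zero _ hg) (hu0 _), S.ord_pow p hg, Multiset.count_add,
        Multiset.count_nsmul, S.count_poleDivisor hg]
      have h1 := hC i.2 p
      have h2 : -((l : ℤ) * (-S.ord p g).toNat) ≤ (i.1 : ℕ) * S.ord p g := by
        have hi : ((i.1 : ℕ) : ℤ) ≤ l := by have := i.1.2; omega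
        rcases le_total 0 (S.ord p g) with h | h
        · rw [Int.toNat_of_nonpos (by omega)]
          simp only [Nat.cast_zero, mul_zero, neg_zero]
          positivity
        · rw [Int.toNat_of_nonneg (by omega)]
          nlinarith
      push_cast
      omega
    have hli : LinearIndependent K
        (fun i : Fin (l + 1) × J ↦ (⟨_, hmem i⟩ : S.rrSpace (l • S.poleDivisor hg + C))) := by
      refine LinearIndependent.of_comp (Submodule.subtype _) ?_
      refine hu.comp (fun i : Fin (l + 1) × J ↦ ((i.1 : ℕ), i.2)) fun a b h ↦ ?_
      simp only [Prod.mk.injEq] at h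
      exact Prod.ext (Fin.ext h.1) h.2
    have := hli.fintype_card_le_finrank.trans hfin
    simpa using this
  by_contra! hlt
  have h1 := bound (C.card + 1)
  have h2 : (C.card + 1 + 1) * ((S.poleDivisor hg).card + 1) ≤ (C.card + 1 + 1) * Fintype.card J :=
    Nat.mul_le_mul_left _ hlt
  nlinarith

/-- The set indexing the partial expansions at the zeros of `g`. -/
abbrev ZeroIndex {g : L} (hg : g ≠ 0) : Type _ :=
  Σ p : (S.finite_support hg).toFinset, Fin (S.ord p g).toNat

lemma exists_linearIndependent {g : L} (hg : g ≠ 0) :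
    ∃ u : S.ZeroIndex hg → L, LinearIndependent K fun i : ℕ × S.ZeroIndex hg ↦ g ^ i.1 * u i.2 := by
  classical
  set T := (S.finite_support hg).toFinset
  let N : ℤ := ∑ p ∈ T, |S.ord p g|
  have hN : ∀ p ∈ T, S.ord p g ≤ N := fun p hp ↦ (le_abs_self _).trans
    (Finset.single_le_sum (f := fun p ↦ |S.ord p g|) (fun _ _ ↦ abs_nonneg _) hp)
  choose u hu0 hu1 hu2 using fun j : S.ZeroIndex hg ↦
    S.exists_ord_eq_forall_le j.1 (T.erase j.1) (Finset.notMem_erase _ _) (j.2 : ℕ) N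
  refine ⟨u, linearIndependent_iff'.mpr fun s c hc ↦ ?_⟩
  by_contra! hne
  -- Choose a nonzero term with minimal power of `g`, then minimal order at its place.
  obtain ⟨i₀, hi₀, hmin⟩ := (s.filter fun i ↦ c i ≠ 0).exists_min_image
    (fun i ↦ toLex (i.1, (i.2.2 : ℕ))) (by simpa [Finset.Nonempty] using hne)
  obtain ⟨his, hci⟩ := Finset.mem_filter.mp hi₀
  obtain ⟨m, ⟨p, hpT⟩, a⟩ := i₀
  have hterm : ∀ i : ℕ × S.ZeroIndex hg, g ^ i.1 * u i.2 ≠ 0 := fun i ↦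
    mul_ne_zero (pow_ne_zero _ hg) (hu0 _)
  have hord : ∀ i : ℕ × S.ZeroIndex hg,
      S.ord p (g ^ i.1 * u i.2) = i.1 * S.ord p g + S.ord p (u i.2) := fun i ↦ by
    rw [S.ord_mul p (pow_ne_zero _ hg) (hu0 _), S.ord_pow p hg]
  have ha : (a : ℤ) < S.ord p g := by have := a.2; simp only at this; omega
  set f := c (m, ⟨⟨p, hpT⟩, a⟩) • (g ^ m * u ⟨⟨p, hpT⟩, a⟩) with hf
  have hf0 : f ≠ 0 := smul_ne_zero hci (hterm (m, ⟨⟨p, hpT⟩, a⟩))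
  have hfp : S.ord p f = m * S.ord p g + a := by
    have h1 := hord (m, ⟨⟨p, hpT⟩, a⟩)
    simp only [hu1 ⟨⟨p, hpT⟩, a⟩] at h1
    rw [hf, Algebra.smul_def, S.ord_mul p _ (hterm (m, ⟨⟨p, hpT⟩, a⟩)), S.ord_algebraMap p hci, h1,
      zero_add]
    simpa using hci
  refine (S.ord_add_eq_left (p := p) hf0 (g := ∑ i ∈ s.erase (m, ⟨⟨p, hpT⟩, a⟩),
    c i • (g ^ i.1 * u i.2)) (Submodule.sum_mem _ fun i hi ↦ ?_)).1
    ((Finset.add_sum_erase _ (fun i ↦ c i • (g ^ i.1 * u i.2)) his).trans hc)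
  obtain ⟨hine, his'⟩ := Finset.mem_erase.mp hi
  by_cases hci' : c i = 0
  · rw [hci', zero_smul]
    exact zero_mem _
  refine Submodule.smul_mem _ _ ((S.mem_leOrd_of_ne_zero (hterm i)).mpr ?_)
  rw [hfp, hord]
  have hle := hmin i (Finset.mem_filter.mpr ⟨his', hci'⟩)
  rw [Prod.Lex.toLex_le_toLex] at hle
  simp only at hle
  obtain ⟨n, ⟨q, hqT⟩, b⟩ := i
  simp only at hle ⊢
  have hgp : 0 ≤ S.ord p g := by omega
  have hnm : (m : ℤ) ≤ n := by rcases hle with h | h <;> omega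
  have hmul : (m : ℤ) * S.ord p g ≤ n * S.ord p g := mul_le_mul_of_nonneg_right hnm hgp
  by_cases hqp : q = p
  · subst hqp
    have hb : S.ord q (u ⟨⟨q, hqT⟩, b⟩) = (b : ℕ) := hu1 ⟨⟨q, hqT⟩, b⟩
    rw [hb]
    rcases hle with h | ⟨rfl, h⟩
    · have : ((m : ℤ) + 1) * S.ord q g ≤ n * S.ord q g :=
        mul_le_mul_of_nonneg_right (by omega) hgp
      rw [add_mul, one_mul] at this
      omega
    · have : (a : ℕ) ≠ b := fun h ↦ hine (by rw [Fin.ext h])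
      omega
  · have h1 := hu2 ⟨⟨q, hqT⟩, b⟩ p (Finset.mem_erase.mpr ⟨fun h ↦ hqp h.symm, hpT⟩)
    have h2 := hN p hpT
    omega

theorem sum_ord_eq_zero {g : L} (hg : g ≠ 0) :
    ∑ p ∈ (S.finite_support hg).toFinset, S.ord p g = 0 := by
  have le : ∀ {g : L} (hg : g ≠ 0), ∑ p ∈ (S.finite_support hg).toFinset, (S.ord p g).toNat ≤
      ∑ p ∈ (S.finite_support hg).toFinset, (-S.ord p g).toNat := by
    intro g hg
    obtain ⟨u, hu⟩ := S.exists_linearIndependent hg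
    have := S.card_le_card_poleDivisor hg hu
    rw [card_poleDivisor, Fintype.card_sigma] at this
    rw [← Finset.sum_attach]
    simpa using this
  have h1 := le hg
  have h2 := le (inv_ne_zero hg)
  have hT : (S.finite_support (inv_ne_zero hg)).toFinset = (S.finite_support hg).toFinset := by
    ext p
    simp [S.ord_inv p hg]
  rw [hT] at h2
  simp only [S.ord_inv _ hg, neg_neg] at h2
  have h3 := le_antisymm h1 h2
  have : ∀ p, S.ord p g = (S.ord p g).toNat - (-S.ord p g).toNat := fun p ↦ by omega
  rw [Finset.sum_congr rfl fun p _ ↦ this p, Finset.sum_sub_distrib, sub_eq_zero]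
  exact_mod_cast h3

end PlaceSystem

end CurveBundle

namespace CurveBundle

open CategoryTheory CategoryTheory.Limits AlgebraicGeometry

section Integral

variable {X : Scheme.{u}} [IsIntegral X]

/-- A rational function which is regular at every point of `U` is a section over `U`. -/
lemma exists_germToFunctionField_eq (U : X.Opens) [Nonempty U] {f : X.functionField}
    (h : ∀ x ∈ U, ∃ a : X.presheaf.stalk x, algebraMap _ X.functionField a = f) :
    ∃ s : Γ(X, U), X.germToFunctionField U s = f := by
  have h' : ∀ x : U, ∃ (V : X.Opens) (_ : Nonempty V) (s : Γ(X, V)), x.1 ∈ V ∧ V ≤ U ∧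
      X.germToFunctionField V s = f := by
    intro x
    obtain ⟨a, ha⟩ := h x x.2
    obtain ⟨V, hV, s, rfl⟩ := X.presheaf.exists_germ_eq a
    have : Nonempty (V ⊓ U : X.Opens) := ⟨⟨x.1, hV, x.2⟩⟩
    refine ⟨V ⊓ U, this, X.presheaf.map (homOfLE inf_le_left).op s, ⟨hV, x.2⟩, inf_le_right, ?_⟩
    have : Nonempty V := ⟨⟨x.1, hV⟩⟩
    rw [← ha, Scheme.algebraMap_germ_eq_germToFunctionField]
    exact TopCat.Presheaf.germ_res_apply X.presheaf _ _ _ _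
  choose V hne s hxV hVU hs using h'
  obtain ⟨t, ht, -⟩ := TopCat.Sheaf.existsUnique_gluing' X.sheaf V U (fun x ↦ homOfLE (hVU x))
    (fun x hx ↦ TopologicalSpace.Opens.mem_iSup.mpr ⟨⟨x, hx⟩, hxV _⟩) s (fun i j ↦ by
      have : Nonempty (V i ⊓ V j : X.Opens) := by
        refine ⟨⟨genericPoint X, ?_, ?_⟩⟩ <;>
        · refine ((genericPoint_spec X).mem_open_set_iff (V _).isOpen).mpr ?_
          simpa using hne _
      apply X.germToFunctionField_injective
      exact ((TopCat.Presheaf.germ_res_apply X.presheaf _ _ _ _).trans (hs i)).trans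
        ((TopCat.Presheaf.germ_res_apply X.presheaf _ _ _ _).trans (hs j)).symm)
  obtain ⟨x⟩ := ‹Nonempty U›
  refine ⟨t, ?_⟩
  rw [← hs x, ← ht x]
  exact (TopCat.Presheaf.germ_res_apply X.presheaf _ _ _ _).symm

variable [IsLocallyNoetherian X]

lemma ord_algebraMap_nonneg {x : X} (a : X.presheaf.stalk x) :
    0 ≤ X.ord (algebraMap _ X.functionField a) x := by
  by_cases hx : Order.coheight x = 1
  · by_cases ha : a = 0
    · simp [ha]
    rw [Scheme.le_ord_iff hx ((FaithfulSMul.algebraMap_eq_zero_iff _ _).not.mpr ha)]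
    have := krullDimLE_of_coheight_le hx.le
    exact Ring.ordFrac_ge_one_of_ne_zero ha
  · rw [Scheme.ord_eq_zero_of_coheight_neq_one hx]

lemma isUnit_of_ord_algebraMap_eq_zero {x : X} (hx : Order.coheight x = 1)
    [IsDiscreteValuationRing (X.presheaf.stalk x)] {a : X.presheaf.stalk x} (ha : a ≠ 0)
    (h : X.ord (algebraMap _ X.functionField a) x = 0) : IsUnit a := by
  rw [Scheme.ord_eq_iff hx ((FaithfulSMul.algebraMap_eq_zero_iff _ _).not.mpr ha)] at h
  exact Ring.isUnit_iff_ordFrac_one_of_isDiscreteValuationRing.mpr h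

lemma exists_algebraMap_eq_of_ord_nonneg {x : X} (hx : Order.coheight x = 1)
    [IsDiscreteValuationRing (X.presheaf.stalk x)] {f : X.functionField} (hf : f ≠ 0)
    (h : 0 ≤ X.ord f x) : ∃ a : X.presheaf.stalk x, algebraMap _ X.functionField a = f := by
  obtain ⟨a, ha⟩ | ⟨a, ha⟩ := ValuationRing.isInteger_or_isInteger (X.presheaf.stalk x) f
  · exact ⟨a, ha⟩
  have ha0 : a ≠ 0 := by
    rintro rfl
    rw [map_zero] at ha
    exact inv_ne_zero hf ha.symm
  have h1 : X.ord (f * f⁻¹) x = X.ord f x + X.ord f⁻¹ x := Scheme.ord_mul hf (inv_ne_zero hf)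
  have h2 : X.ord (1 : X.functionField) x = 0 := by
    have : Nonempty (⊤ : X.Opens) := ⟨⟨x, trivial⟩⟩
    simpa using Scheme.ord_of_isUnit (U := ⊤) (isUnit_one) (x := x) trivial
  have h3 := ord_algebraMap_nonneg a
  rw [ha] at h3
  rw [mul_inv_cancel₀ hf, h2] at h1
  obtain ⟨u, rfl⟩ := isUnit_of_ord_algebraMap_eq_zero hx ha0 (by rw [ha]; omega)
  refine ⟨(u⁻¹ : (X.presheaf.stalk x)ˣ), ?_⟩
  rw [← inv_inv f, ← ha]
  refine eq_inv_of_mul_eq_one_left ?_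
  rw [← map_mul, Units.inv_mul, map_one]

end Integral

section Curve

variable {K : Type u} [Field K] [IsAlgClosed K] (C : SmoothProjectiveCurve K)

lemma finite_compl_of_nonempty (U : C.X.Opens) [Nonempty U] : (U : Set C.X)ᶜ.Finite := by
  have : IsNoetherian C.X := {}
  have hU : genericPoint C.X ∈ U :=
    ((genericPoint_spec C.X).mem_open_set_iff U.isOpen).mpr (by simpa using ‹Nonempty U›)
  obtain ⟨S, hS, hirr, hc, h⟩ :=
    TopologicalSpace.NoetherianSpace.exists_finite_set_isClosed_irreducible
      (isClosed_compl_iff.mpr U.isOpen)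
  rw [h]
  refine hS.sUnion fun t ht ↦ ?_
  obtain ⟨y, hy⟩ := QuasiSober.sober (hc t ht) (hirr t ht)
  have hyU : y ∈ (U : Set C.X)ᶜ := h ▸ Set.mem_sUnion_of_mem hy.mem ht
  have hy' : y ≠ genericPoint C.X := fun h ↦ hyU (h ▸ hU)
  rw [← hy.def, (isClosed_of_ne_genericPoint C hy').closure_eq]
  exact Set.finite_singleton y

lemma constants_bijective : Function.Bijective (constants C) := by
  refine IsAlgClosed.ringHom_bijective_of_isIntegral _ ?_
  apply RingHom.isIntegral_respectsIso.2 (e := (Scheme.ΓSpecIso _).symm.commRingCatIsoToRingEquiv)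
  exact isIntegral_appTop_of_universallyClosed C.hom

instance : Nonempty (⊤ : C.X.Opens) := ⟨⟨genericPoint C.X, trivial⟩⟩

/-- The function field of a curve is an extension of the base field. -/
noncomputable abbrev functionFieldAlgebra : Algebra K C.X.functionField :=
  ((C.X.germToFunctionField ⊤).hom.comp (constants C)).toAlgebra

lemma exists_ord_neg {p q : C.X} (hp : p ≠ genericPoint C.X) 
    (hpq : p ≠ q) : ∃ f : C.X.functionField, f ≠ 0 ∧ C.X.ord f p < 0 ∧ 0 ≤ C.X.ord f q := by
  by_contra! hcon
  have := isDiscreteValuationRing_stalk C hp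
  have hle : ∀ a : C.X.presheaf.stalk q, algebraMap _ C.X.functionField a ∈
      (algebraMap (C.X.presheaf.stalk p) C.X.functionField).range := by
    intro a
    by_cases ha : algebraMap _ C.X.functionField a = 0
    · rw [ha]; exact zero_mem _
    refine exists_algebraMap_eq_of_ord_nonneg (coheight_eq_one C hp) ha ?_
    by_contra! hlt
    exact absurd (hcon _ ha hlt) (not_lt.mpr (ord_algebraMap_nonneg a))
  let e := RingEquiv.ofBijective (algebraMap (C.X.presheaf.stalk p) C.X.functionField).rangeRestrict
    ⟨fun a b h ↦ IsFractionRing.injective _ C.X.functionField (congrArg Subtype.val h),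
      RingHom.rangeRestrict_surjective _⟩
  let j : C.X.presheaf.stalk q →+* C.X.presheaf.stalk p :=
    e.symm.toRingHom.comp ((algebraMap _ C.X.functionField).codRestrict _ hle)
  have hj : ∀ a, algebraMap _ C.X.functionField (j a) = algebraMap _ C.X.functionField a :=
    fun a ↦ congrArg Subtype.val (e.apply_symm_apply
      ((algebraMap _ C.X.functionField).codRestrict _ hle a))
  have hX : C.X.IsSeparated := by
    rw [Scheme.isSeparated_iff, ← terminal.comp_from C.hom]
    infer_instance
  let ηp := C.X.presheaf.stalkSpecializes (genericPoint_specializes p)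
  let ηq := C.X.presheaf.stalkSpecializes (genericPoint_specializes q)
  have hη : CommRingCat.ofHom j ≫ ηp = ηq := by
    ext a
    exact hj a
  have : IsDominant (Spec.map ηp) := by
    refine ⟨(PrimeSpectrum.denseRange_comap_iff_ker_le_nilRadical ηp.hom).mpr ?_⟩
    rw [(RingHom.injective_iff_ker_eq_bot ηp.hom).mp
      (IsFractionRing.injective (C.X.presheaf.stalk p) C.X.functionField)]
    exact bot_le
  have h : Spec.map (CommRingCat.ofHom j) ≫ C.X.fromSpecStalk q = C.X.fromSpecStalk p := by
    refine ext_of_isDominant (Spec.map ηp) ?_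
    rw [← Category.assoc, ← Spec.map_comp, hη, Scheme.SpecMap_stalkSpecializes_fromSpecStalk,
      Scheme.SpecMap_stalkSpecializes_fromSpecStalk]
  have hspec : p ⤳ q := by
    rw [← C.X.fromSpecStalk_closedPoint (x := p), ← h]
    exact C.X.range_fromSpecStalk.le ⟨_, rfl⟩
  exact hpq (specializes_iff_mem_closure.mp hspec |> fun h ↦ by
    rw [(isClosed_of_ne_genericPoint C hp).closure_eq] at h
    exact (Set.mem_singleton_iff.mp h).symm)

/-- The places of the function field of a curve given by the points of the curve. -/
noncomputable def placeSystem : @PlaceSystem K C.X.functionField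
    {x : C.X // x ≠ genericPoint C.X} _ _ (functionFieldAlgebra C) :=
  letI := functionFieldAlgebra C
  { ord := fun p f ↦ C.X.ord f p
    ord_mul := fun p f g hf hg ↦ Scheme.ord_mul hf hg
    min_le_ord_add := fun p f g h _ _ ↦ by
      have := isDiscreteValuationRing_stalk C p.2
      exact Scheme.ord_add h
    exists_ord_eq_one := fun p ↦ by
      have := isDiscreteValuationRing_stalk C p.2
      obtain ⟨t, ht⟩ := IsDiscreteValuationRing.exists_irreducible (C.X.presheaf.stalk p.1)
      have h0 : algebraMap _ C.X.functionField t ≠ 0 :=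
        (FaithfulSMul.algebraMap_eq_zero_iff _ _).not.mpr ht.ne_zero
      refine ⟨algebraMap _ _ t, h0, ?_⟩
      rw [Scheme.ord_eq_iff (coheight_eq_one C p.2) h0]
      exact Ring.ordFrac_irreducible ht
    ord_algebraMap := fun p c hc ↦
      Scheme.ord_of_isUnit (U := ⊤) ((isUnit_iff_ne_zero.mpr hc).map (constants C)) trivial
    exists_const := fun p f hf h ↦ by
      have := isDiscreteValuationRing_stalk C p.2
      obtain ⟨a, ha⟩ := exists_algebraMap_eq_of_ord_nonneg (coheight_eq_one C p.2) hf h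
      obtain ⟨c, hc⟩ := (residue_germ_constants_bijective C
        (isClosed_of_ne_genericPoint C p.2)).2 (IsLocalRing.residue _ a)
      refine ⟨c, or_iff_not_imp_left.mpr fun hne ↦ ?_⟩
      set b := a - C.X.presheaf.germ ⊤ p.1 trivial (constants C c) with hb
      have hfb : f - algebraMap K C.X.functionField c = algebraMap _ C.X.functionField b := by
        rw [hb, map_sub, ha]
        exact congrArg (f - ·) (Scheme.algebraMap_germ_eq_germToFunctionField C.X (U := ⊤) (x := p.1)
          trivial (constants C c)).symm
      rw [hfb] at hne ⊢
      refine lt_of_le_of_ne (ord_algebraMap_nonneg b) fun h0 ↦ ?_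
      have hu := isUnit_of_ord_algebraMap_eq_zero (coheight_eq_one C p.2)
        (fun h ↦ hne (by rw [h, map_zero])) h0.symm
      have hres : IsLocalRing.residue _ b = 0 := by
        rw [hb, map_sub, sub_eq_zero, ← hc]
        rfl
      rw [IsLocalRing.residue_eq_zero_iff] at hres
      exact hres hu
    finite_support := fun {f} hf ↦ by
      obtain ⟨U, -, f', _, rfl, hu⟩ := exists_isUnit_germ_eq C.X f hf
      exact ((finite_compl_of_nonempty C U).preimage Subtype.val_injective.injOn).subset
        fun p hp hpU ↦ hp (Scheme.ord_of_isUnit hu hpU)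
    exists_eq_const := fun {f} hf h ↦ by
      obtain ⟨s, hs⟩ := exists_germToFunctionField_eq (⊤ : C.X.Opens) (f := f) fun x _ ↦ by
        by_cases hx : x = genericPoint C.X
        · subst hx
          exact ⟨f, congr(($(C.X.presheaf.stalkSpecializes_refl (genericPoint C.X))).hom f)⟩
        · have := isDiscreteValuationRing_stalk C hx
          exact exists_algebraMap_eq_of_ord_nonneg (coheight_eq_one C hx) hf (h ⟨x, hx⟩)
      obtain ⟨c, rfl⟩ := (constants_bijective C).2 s
      exact ⟨c, hs⟩
    exists_pole := fun {p q} hpq ↦ exists_ord_neg C p.2 (Subtype.coe_ne_coe.mpr hpq) }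

/-- The degree of a principal divisor on a smooth projective curve is zero. -/
theorem finsum_ord_eq_zero {f : C.X.functionField} (hf : f ≠ 0) : ∑ᶠ x, C.X.ord f x = 0 := by
  let := functionFieldAlgebra C
  have h0 := (placeSystem C).sum_ord_eq_zero hf
  rw [← finsum_eq_sum_of_support_subset _ (by simp [Function.support])] at h0
  rw [← h0]
  have h : ∀ x, C.X.ord f x = ∑ᶠ _ : x ≠ genericPoint C.X, C.X.ord f x := by
    intro x
    by_cases hx : x = genericPoint C.X
    · subst hx
      rw [Scheme.ord_eq_zero_of_coheight_neq_one (by simp [coheight_genericPoint])]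
      simp
    · simp [hx]
  rw [finsum_congr h, ← finsum_subtype_eq_finsum_cond]
  rfl

end Curve

section Transition

variable {X : Scheme.{u}} {M : X.Modules} {n : ℕ}

/-- The matrix expressing the sections `b` in terms of the frame `e`. -/
noncomputable def IsFrame.coordMatrix {U : X.Opens} {e : Fin n → Γ(M, U)} (he : IsFrame M U e)
    {m : ℕ} (b : Fin m → Γ(M, U)) : Matrix (Fin n) (Fin m) Γ(X, U) :=
  he.basis.toMatrix b

lemma IsFrame.sum_coordMatrix {U : X.Opens} {e : Fin n → Γ(M, U)} (he : IsFrame M U e)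
    {m : ℕ} (b : Fin m → Γ(M, U)) (j : Fin m) : ∑ i, he.coordMatrix b i j • e i = b j := by
  simpa [IsFrame.coordMatrix] using he.basis.sum_toMatrix_smul_self b j

lemma IsFrame.matrix_ext {U : X.Opens} {e : Fin n → Γ(M, U)} (he : IsFrame M U e) {m : ℕ}
    {A B : Matrix (Fin n) (Fin m) Γ(X, U)} (h : ∀ j, ∑ i, A i j • e i = ∑ i, B i j • e i) :
    A = B := by
  ext i j
  have := (he U le_rfl).1 (a₁ := fun i ↦ A i j) (a₂ := fun i ↦ B i j) (by simpa using h j)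
  exact congrFun this i

lemma IsFrame.isUnit_det {U : X.Opens} {b e : Fin n → Γ(M, U)} (hb : IsFrame M U b)
    (he : IsFrame M U e) : IsUnit (he.coordMatrix b).det := by
  have : (he.basis.toMatrix hb.basis).det * (hb.basis.toMatrix he.basis).det = 1 := by
    rw [← Matrix.det_mul, Module.Basis.toMatrix_mul_toMatrix_flip, Matrix.det_one]
  have h := IsUnit.of_mul_eq_one _ this
  rwa [show (hb.basis : Fin n → _) = b from funext hb.basis_apply] at h

/-- Restriction of a matrix of functions to a smaller open set. -/
noncomputable def resMatrix {m : ℕ} {U V : X.Opens} (h : V ≤ U) (A : Matrix (Fin n) (Fin m) Γ(X, U)) :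
    Matrix (Fin n) (Fin m) Γ(X, V) :=
  A.map (X.presheaf.map (homOfLE h).op).hom

lemma sum_resMatrix {m : ℕ} {U V : X.Opens} (h : V ≤ U) {A : Matrix (Fin n) (Fin m) Γ(X, U)}
    {e : Fin n → Γ(M, U)} {b : Γ(M, U)} {j : Fin m} (hb : b = ∑ i, A i j • e i) :
    res M h b = ∑ i, resMatrix h A i j • res M h (e i) := by
  simp [hb, resMatrix]

variable [IsIntegral X]

lemma genericPoint_mem (U : X.Opens) [Nonempty U] : genericPoint X ∈ U :=
  ((genericPoint_spec X).mem_open_set_iff U.isOpen).mpr (by simpa using ‹Nonempty U›)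

instance (U V : X.Opens) [Nonempty U] [Nonempty V] : Nonempty (U ⊓ V : X.Opens) :=
  ⟨⟨genericPoint X, genericPoint_mem U, genericPoint_mem V⟩⟩

lemma germToFunctionField_res {U V : X.Opens} (h : V ≤ U) [Nonempty U] [Nonempty V] (a : Γ(X, U)) :
    X.germToFunctionField V (X.presheaf.map (homOfLE h).op a) = X.germToFunctionField U a :=
  TopCat.Presheaf.germ_res_apply X.presheaf _ _ _ _

lemma germToFunctionField_det_resMatrix {U V : X.Opens} (h : V ≤ U) [Nonempty U] [Nonempty V]
    (A : Matrix (Fin n) (Fin n) Γ(X, U)) :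
    X.germToFunctionField V (resMatrix h A).det = X.germToFunctionField U A.det := by
  rw [← germToFunctionField_res h]
  congr 1
  exact (RingHom.map_det (X.presheaf.map (homOfLE h).op).hom A).symm

/-- The determinant of the transition matrix between two frames. -/
noncomputable def transitionDet {U V : X.Opens} [Nonempty U] [Nonempty V] (b : Fin n → Γ(M, U))
    {e : Fin n → Γ(M, V)} (he : IsFrame M V e) : X.functionField :=
  X.germToFunctionField (U ⊓ V)
    ((he.restrict inf_le_right).coordMatrix fun j ↦ res M inf_le_left (b j)).det

lemma isTransitionDet_transitionDet {U V : X.Opens} [Nonempty U] [Nonempty V] (b : Fin n → Γ(M, U))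
    {e : Fin n → Γ(M, V)} (he : IsFrame M V e) : IsTransitionDet M b e (transitionDet b he) :=
  ⟨U ⊓ V, inf_le_left, inf_le_right, inferInstance, _,
    fun j ↦ ((he.restrict inf_le_right).sum_coordMatrix (fun j ↦ res M inf_le_left (b j)) j).symm,
    rfl⟩

lemma IsTransitionDet.eq {U V : X.Opens} {b : Fin n → Γ(M, U)}
    {e : Fin n → Γ(M, V)} (he : IsFrame M V e) {g g' : X.functionField}
    (h : IsTransitionDet M b e g) (h' : IsTransitionDet M b e g') : g = g' := by
  obtain ⟨W, hU, hV, _, A, hA, rfl⟩ := h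
  obtain ⟨W', hU', hV', _, A', hA', rfl⟩ := h'
  rw [← germToFunctionField_det_resMatrix (inf_le_left : W ⊓ W' ≤ W) A,
    ← germToFunctionField_det_resMatrix (inf_le_right : W ⊓ W' ≤ W') A']
  congr 2
  refine (he.restrict (inf_le_left.trans hV)).matrix_ext fun j ↦ ?_
  have h1 := sum_resMatrix (inf_le_left : W ⊓ W' ≤ W) (hA j)
  have h2 := sum_resMatrix (inf_le_right : W ⊓ W' ≤ W') (hA' j)
  simp only [res_res] at h1 h2
  exact h1.symm.trans h2

lemma IsTransitionDet.mul {U V W : X.Opens} {b : Fin n → Γ(M, U)} {e : Fin n → Γ(M, V)}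
    {f : Fin n → Γ(M, W)} {g h : X.functionField} (hbe : IsTransitionDet M b e g)
    (hef : IsTransitionDet M e f h) : IsTransitionDet M b f (h * g) := by
  obtain ⟨Y, hU, hV, _, A, hA, rfl⟩ := hbe
  obtain ⟨Z, hV', hW, _, B, hB, rfl⟩ := hef
  refine ⟨Y ⊓ Z, inf_le_left.trans hU, inf_le_right.trans hW, inferInstance,
    resMatrix inf_le_right B * resMatrix inf_le_left A, fun j ↦ ?_, ?_⟩
  · have h1 := sum_resMatrix (inf_le_left : Y ⊓ Z ≤ Y) (hA j)
    have h2 := fun j ↦ sum_resMatrix (inf_le_right : Y ⊓ Z ≤ Z) (hB j)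
    simp only [res_res] at h1 h2
    rw [h1]
    simp_rw [h2, Matrix.mul_apply, Finset.smul_sum, Finset.sum_smul, smul_smul]
    rw [Finset.sum_comm]
    simp_rw [mul_comm]
  · rw [Matrix.det_mul, map_mul, germToFunctionField_det_resMatrix,
      germToFunctionField_det_resMatrix]

lemma transitionDet_ne_zero {U V : X.Opens} [Nonempty U] [Nonempty V] {b : Fin n → Γ(M, U)}
    (hb : IsFrame M U b) {e : Fin n → Γ(M, V)} (he : IsFrame M V e) : transitionDet b he ≠ 0 := by
  have := (((hb.restrict inf_le_left).isUnit_det (he.restrict inf_le_right)).map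
    (X.germToFunctionField (U ⊓ V)).hom).ne_zero
  exact this

lemma IsVectorBundle.rank_eq (hM : IsVectorBundle n M) {m : ℕ} {U : X.Opens} [Nonempty U]
    {b : Fin m → Γ(M, U)} (hb : IsFrame M U b) : m = n := by
  obtain ⟨V, hx, e, he⟩ := hM (genericPoint X)
  have : Nonempty V := ⟨⟨_, hx⟩⟩
  exact (hb.restrict (inf_le_left : U ⊓ V ≤ U)).rank_eq (he.restrict inf_le_right)

variable [IsLocallyNoetherian X]

lemma ord_transitionDet {U V : X.Opens} [Nonempty U] [Nonempty V] {b : Fin n → Γ(M, U)}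
    (hb : IsFrame M U b) {e : Fin n → Γ(M, V)} (he : IsFrame M V e) {x : X} (hU : x ∈ U)
    (hV : x ∈ V) : X.ord (transitionDet b he) x = 0 :=
  Scheme.ord_of_isUnit ((hb.restrict inf_le_left).isUnit_det (he.restrict inf_le_right))
    ⟨hU, hV⟩

lemma HasOrderAt.eq_ord {U : X.Opens} {b : Fin n → Γ(M, U)} (hb : IsFrame M U b) [Nonempty U]
    {x : X} {m : ℤ} (h : HasOrderAt M b x m) {V : X.Opens} [Nonempty V] {e : Fin n → Γ(M, V)}
    (he : IsFrame M V e) (hx : x ∈ V) : m = X.ord (transitionDet b he) x := by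
  obtain ⟨V', e', g, hx', he', hg, rfl⟩ := h
  have : Nonempty V' := ⟨⟨x, hx'⟩⟩
  rw [hg.eq he' (isTransitionDet_transitionDet b he')]
  rw [IsTransitionDet.eq he (isTransitionDet_transitionDet b he)
    ((isTransitionDet_transitionDet b he').mul (isTransitionDet_transitionDet e' he)),
    Scheme.ord_mul (transitionDet_ne_zero he' he) (transitionDet_ne_zero hb he'),
    ord_transitionDet he' he hx' hx, zero_add]

lemma hasOrderAt_ord {U V : X.Opens} [Nonempty U] [Nonempty V] (b : Fin n → Γ(M, U))
    {e : Fin n → Γ(M, V)} (he : IsFrame M V e) {x : X} (hx : x ∈ V) :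
    HasOrderAt M b x (X.ord (transitionDet b he) x) :=
  ⟨V, e, _, hx, he, isTransitionDet_transitionDet b he, rfl⟩

/-- The orders of two rational sections of the determinant differ by the order of a rational
function. -/
lemma HasOrderAt.eq_add {U U' : X.Opens} [Nonempty U] [Nonempty U'] {b : Fin n → Γ(M, U)}
    {b' : Fin n → Γ(M, U')} (hb : IsFrame M U b) (hb' : IsFrame M U' b') {x : X} {m m' : ℤ}
    (h : HasOrderAt M b x m) (h' : HasOrderAt M b' x m') :
    m' = m + X.ord (transitionDet b' hb) x := by
  obtain ⟨V, e, g, hx, he, -, -⟩ := id h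
  have : Nonempty V := ⟨⟨x, hx⟩⟩
  rw [h.eq_ord hb he hx, h'.eq_ord hb' he hx, IsTransitionDet.eq he
    (isTransitionDet_transitionDet b' he)
    ((isTransitionDet_transitionDet b' hb).mul (isTransitionDet_transitionDet b he)),
    Scheme.ord_mul (transitionDet_ne_zero hb he) (transitionDet_ne_zero hb' hb)]

lemma HasOrderAt.eq_zero {U : X.Opens} {b : Fin n → Γ(M, U)} (hb : IsFrame M U b)
    {x : X} (hx : x ∈ U) {m : ℤ} (h : HasOrderAt M b x m) : m = 0 := by
  have : Nonempty U := ⟨⟨x, hx⟩⟩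
  rw [h.eq_ord hb hb hx, ord_transitionDet hb hb hx hx]

lemma IsVectorBundle.exists_hasOrderAt (hM : IsVectorBundle n M) {U : X.Opens} [Nonempty U]
    (b : Fin n → Γ(M, U)) (x : X) : ∃ m, HasOrderAt M b x m := by
  obtain ⟨V, hx, e, he⟩ := hM x
  have : Nonempty V := ⟨⟨x, hx⟩⟩
  exact ⟨_, hasOrderAt_ord b he hx⟩

end Transition

section Block

variable {X : Scheme.{u}} [IsIntegral X] {S : ShortComplex X.Modules}

/-- The determinant of the transition matrix between adapted frames of a short exact sequence. -/
lemma IsTransitionDet.append (hS : S.ShortExact) {k q : ℕ} {U V : X.Opens}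
    [Nonempty U] [Nonempty V] {f : Fin k → Γ(S.X₁, U)} {e : Fin q → Γ(S.X₂, U)}
    {f' : Fin k → Γ(S.X₁, V)} (hf' : IsFrame S.X₁ V f') {e' : Fin q → Γ(S.X₂, V)}
    (he' : IsFrame S.X₃ V fun i ↦ S.g.app V (e' i)) :
    IsTransitionDet S.X₂ (Fin.append (fun i ↦ S.f.app U (f i)) e)
      (Fin.append (fun i ↦ S.f.app V (f' i)) e')
      (transitionDet f hf' * transitionDet (fun i ↦ S.g.app U (e i)) he') := by
  have := hS.mono_f
  set A := (hf'.restrict (inf_le_right : U ⊓ V ≤ V)).coordMatrix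
    fun j ↦ res S.X₁ inf_le_left (f j) with hA
  set B := (he'.restrict (inf_le_right : U ⊓ V ≤ V)).coordMatrix
    fun j ↦ res S.X₃ inf_le_left (S.g.app U (e j)) with hB
  choose t ht using fun j ↦ exists_app_eq_of_exact hS.exact (U := U ⊓ V)
    (s := res S.X₂ inf_le_left (e j) - ∑ i, B i j • res S.X₂ inf_le_right (e' i)) (by
      rw [map_sub, sub_eq_zero, app_res,
        ← (he'.restrict (inf_le_right : U ⊓ V ≤ V)).sum_coordMatrix
          (fun j ↦ res S.X₃ inf_le_left (S.g.app U (e j))) j]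
      simp [hB])
  set D := (hf'.restrict (inf_le_right : U ⊓ V ≤ V)).coordMatrix t with hD
  refine ⟨U ⊓ V, inf_le_left, inf_le_right, inferInstance,
    Matrix.reindex finSumFinEquiv finSumFinEquiv (Matrix.fromBlocks A D 0 B), fun j ↦ ?_, ?_⟩
  · rw [Fin.sum_univ_add]
    induction j using Fin.addCases with
    | left j =>
      have := congrArg (S.f.app (U ⊓ V)) ((hf'.restrict (inf_le_right : U ⊓ V ≤ V)).sum_coordMatrix
        (fun j ↦ res S.X₁ inf_le_left (f j)) j)
      simp only [Fin.append_left, Fin.append_right]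
      rw [← app_res, ← this]
      simp [hA]
    | right j =>
      have := congrArg (S.f.app (U ⊓ V))
        ((hf'.restrict (inf_le_right : U ⊓ V ≤ V)).sum_coordMatrix t j)
      simp only [Fin.append_left, Fin.append_right]
      rw [ht, eq_sub_iff_add_eq] at this
      rw [← this]
      simp [hD]
  · rw [Matrix.det_reindex_self, Matrix.det_fromBlocks_zero₂₁, map_mul]
    rfl

end Block

section Curve

variable {K : Type u} [Field K] [IsAlgClosed K] {C : SmoothProjectiveCurve K} {M : C.X.Modules}

lemma HasOrderAt.finite_support {n : ℕ} {U : C.X.Opens} [Nonempty U] {b : Fin n → Γ(M, U)}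
    (hb : IsFrame M U b) {m : C.X → ℤ} (h : ∀ x, HasOrderAt M b x (m x)) : m.support.Finite :=
  (finite_compl_of_nonempty C U).subset fun x hx hxU ↦ hx ((h x).eq_zero hb hxU)

lemma IsVectorBundle.exists_isDegree {n : ℕ} (hM : IsVectorBundle n M) : ∃ d, IsDegree M d := by
  obtain ⟨U, hx, b, hb⟩ := hM (genericPoint C.X)
  have : Nonempty U := ⟨⟨_, hx⟩⟩
  choose m hm using fun x ↦ hM.exists_hasOrderAt b x
  exact ⟨_, n, U, b, m, this, hb, hm, HasOrderAt.finite_support hb hm, rfl⟩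

lemma IsVectorBundle.isDegree_degree {n : ℕ} (hM : IsVectorBundle n M) :
    IsDegree M (degree M) := by
  rw [degree, dif_pos hM.exists_isDegree]
  exact hM.exists_isDegree.choose_spec

/-- The degree of a vector bundle can be computed with any generic frame. -/
lemma IsVectorBundle.degree_eq_finsum {n : ℕ} (hM : IsVectorBundle n M) {U : C.X.Opens}
    [Nonempty U] {b : Fin n → Γ(M, U)} (hb : IsFrame M U b) {m : C.X → ℤ}
    (hm : ∀ x, HasOrderAt M b x (m x)) : degree M = ∑ᶠ x, m x := by
  obtain ⟨n', U', b', m', _, hb', hm', hfin', hd⟩ := hM.isDegree_degree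
  obtain rfl := hM.rank_eq hb'
  have h : ∀ x, m' x = m x + C.X.ord (transitionDet b' hb) x := fun x ↦
    (hm x).eq_add hb hb' (hm' x)
  have hfin := HasOrderAt.finite_support hb hm
  rw [hd, finsum_congr h, finsum_add_distrib hfin, finsum_ord_eq_zero C
    (transitionDet_ne_zero hb' hb), add_zero]
  refine (hfin.union hfin').subset fun x hx ↦ ?_
  by_contra! hcon
  simp only [Set.mem_union, Function.mem_support, not_or, not_not] at hcon
  have := h x
  rw [hcon.1, hcon.2, zero_add] at this
  exact hx this.symm

/-- The degree is additive on short exact sequences of vector bundles. -/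
theorem degree_add {S : ShortComplex C.X.Modules} (hS : S.ShortExact) {k q : ℕ}
    (h₁ : IsVectorBundle k S.X₁) (h₃ : IsVectorBundle q S.X₃) :
    degree S.X₂ = degree S.X₁ + degree S.X₃ := by
  obtain ⟨U, hxU, f, e, hf, he⟩ := exists_adapted_frame hS h₁ h₃ (genericPoint C.X)
  have : Nonempty U := ⟨⟨_, hxU⟩⟩
  choose m₁ hm₁ using fun x ↦ h₁.exists_hasOrderAt f x
  choose m₃ hm₃ using fun x ↦ h₃.exists_hasOrderAt (fun i ↦ S.g.app U (e i)) x
  rw [h₁.degree_eq_finsum hf hm₁, h₃.degree_eq_finsum he hm₃, ← finsum_add_distrib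
    (HasOrderAt.finite_support hf hm₁) (HasOrderAt.finite_support he hm₃)]
  refine (IsVectorBundle.of_shortExact hS h₁ h₃).degree_eq_finsum (hf.append hS he) fun x ↦ ?_
  obtain ⟨V, hxV, f', e', hf', he'⟩ := exists_adapted_frame hS h₁ h₃ x
  have : Nonempty V := ⟨⟨_, hxV⟩⟩
  refine ⟨V, _, _, hxV, hf'.append hS he', IsTransitionDet.append hS hf' he', ?_⟩
  rw [Scheme.ord_mul (transitionDet_ne_zero hf hf') (transitionDet_ne_zero he he'),
    (hm₁ x).eq_ord hf hf' hxV, (hm₃ x).eq_ord he he' hxV]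

end Curve

section Frame

variable {X : Scheme.{u}} {M : X.Modules} {n : ℕ}

/-- The coordinates of a section with respect to a frame. -/
noncomputable def IsFrame.coord {U V : X.Opens} {b : Fin n → Γ(M, U)} (hb : IsFrame M U b)
    (h : V ≤ U) (s : Γ(M, V)) : Fin n → Γ(X, V) :=
  (hb.restrict h).basis.repr s

lemma IsFrame.sum_coord {U V : X.Opens} {b : Fin n → Γ(M, U)} (hb : IsFrame M U b)
    (h : V ≤ U) (s : Γ(M, V)) : ∑ i, hb.coord h s i • res M h (b i) = s := by
  simpa [IsFrame.coord] using (hb.restrict h).basis.sum_repr s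

lemma IsFrame.eq_of_sum_eq {U V : X.Opens} {b : Fin n → Γ(M, U)} (hb : IsFrame M U b)
    (h : V ≤ U) {a a' : Fin n → Γ(X, V)}
    (haa' : ∑ i, a i • res M h (b i) = ∑ i, a' i • res M h (b i)) : a = a' :=
  (hb V h).1 haa'

lemma IsFrame.coord_eq {U V : X.Opens} {b : Fin n → Γ(M, U)} (hb : IsFrame M U b)
    (h : V ≤ U) {s : Γ(M, V)} {a : Fin n → Γ(X, V)} (hs : ∑ i, a i • res M h (b i) = s) :
    hb.coord h s = a :=
  hb.eq_of_sum_eq h ((hb.sum_coord h s).trans hs.symm)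

lemma IsFrame.coord_res {U V W : X.Opens} {b : Fin n → Γ(M, U)} (hb : IsFrame M U b)
    (h : V ≤ U) (h' : W ≤ V) (s : Γ(M, V)) (i : Fin n) :
    hb.coord (h'.trans h) (res M h' s) i = X.presheaf.map (homOfLE h').op (hb.coord h s i) := by
  refine congrFun (hb.coord_eq (h'.trans h) (a := fun i ↦
    X.presheaf.map (homOfLE h').op (hb.coord h s i)) ?_) i
  conv_rhs => rw [← hb.sum_coord h s]
  simp

lemma IsFrame.coord_add {U V : X.Opens} {b : Fin n → Γ(M, U)} (hb : IsFrame M U b)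
    (h : V ≤ U) (s t : Γ(M, V)) (i : Fin n) :
    hb.coord h (s + t) i = hb.coord h s i + hb.coord h t i := by
  simp [IsFrame.coord]

lemma IsFrame.coord_smul {U V : X.Opens} {b : Fin n → Γ(M, U)} (hb : IsFrame M U b)
    (h : V ≤ U) (c : Γ(X, V)) (s : Γ(M, V)) (i : Fin n) :
    hb.coord h (c • s) i = c * hb.coord h s i := by
  simp [IsFrame.coord]

/-- Sections which are locally independent and locally generate form a frame. -/
lemma IsFrame.of_locally {U : X.Opens} {e : Fin n → Γ(M, U)}
    (hinj : ∀ (V : X.Opens) (h : V ≤ U) (a : Fin n → Γ(X, V)),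
      ∑ i, a i • res M h (e i) = 0 → a = 0)
    (hsurj : ∀ (V : X.Opens) (h : V ≤ U) (s : Γ(M, V)), ∀ x ∈ V, ∃ (W : X.Opens) (hW : W ≤ V),
      x ∈ W ∧ ∃ a : Fin n → Γ(X, W), ∑ i, a i • res M (hW.trans h) (e i) = res M hW s) :
    IsFrame M U e := by
  have hinj' : ∀ (V : X.Opens) (h : V ≤ U) (a a' : Fin n → Γ(X, V)),
      ∑ i, a i • res M h (e i) = ∑ i, a' i • res M h (e i) → a = a' := fun V h a a' haa' ↦
    sub_eq_zero.mp (hinj V h (a - a') (by simp [sub_smul, haa']))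
  refine fun V h ↦ ⟨fun a a' ↦ hinj' V h a a', fun s ↦ ?_⟩
  choose W hW hxW a ha using fun x : V ↦ hsurj V h s x x.2
  have hcov : V ≤ iSup W := fun x hx ↦ TopologicalSpace.Opens.mem_iSup.mpr ⟨⟨x, hx⟩, hxW _⟩
  have hglue : ∀ i, ∃ c : Γ(X, V), ∀ x, X.presheaf.map (homOfLE (hW x)).op c = a x i := by
    intro i
    obtain ⟨c, hc, -⟩ := TopCat.Sheaf.existsUnique_gluing' X.sheaf W V (fun x ↦ homOfLE (hW x))
      hcov (fun x ↦ a x i) (fun x y ↦ by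
        have hx := congrArg (res M (inf_le_left : W x ⊓ W y ≤ W x)) (ha x)
        have hy := congrArg (res M (inf_le_right : W x ⊓ W y ≤ W y)) (ha y)
        simp only [res_sum, res_smul, res_res] at hx hy
        exact congrFun (hinj' (W x ⊓ W y) ((inf_le_left.trans (hW x)).trans h) _ _
          (hx.trans hy.symm)) i)
    exact ⟨c, hc⟩
  choose c hc using hglue
  refine ⟨c, eq_of_res_eq fun x hx ↦ ⟨W ⟨x, hx⟩, hW _, hxW _, ?_⟩⟩
  rw [← ha]
  simp [hc]

end Frame

lemma subsingleton_sections {X : Scheme.{u}} {V : X.Opens} (h : ¬ Nonempty V) : Subsingleton Γ(X, V) := by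
  have : V = ⊥ := by
    ext x
    exact ⟨fun hx ↦ h ⟨⟨x, hx⟩⟩, fun hx ↦ hx.elim⟩
  subst this
  exact CommRingCat.subsingleton_of_isTerminal X.sheaf.isTerminalOfEmpty

section Saturation

variable {X : Scheme.{u}} [IsIntegral X] {M : X.Modules} {n : ℕ} {U : X.Opens} [Nonempty U]
  {b : Fin (n + 1) → Γ(M, U)}

lemma map_injective {V W : X.Opens} (h : W ≤ V) [Nonempty W] :
    Function.Injective (X.presheaf.map (homOfLE h).op) :=
  map_injective_of_isIntegral X (homOfLE h)

/-- The sections of `M` which are generically multiples of `b 0`. -/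
noncomputable def IsFrame.saturation (hb : IsFrame M U b) : LocalSubmodule M where
  obj V :=
    { carrier := {s | ∀ i, i ≠ 0 →
        hb.coord (inf_le_left : U ⊓ V ≤ U) (res M inf_le_right s) i = 0}
      add_mem' := fun {s t} hs ht i hi ↦ by
        rw [res_add, hb.coord_add, hs i hi, ht i hi, add_zero]
      zero_mem' := fun i hi ↦ by simp [IsFrame.coord]
      smul_mem' := fun c s hs i hi ↦ by
        rw [res_smul, hb.coord_smul, hs i hi, mul_zero] }
  res_mem {V W} h s hs i hi := by
    have h1 : U ⊓ W ≤ U ⊓ V := inf_le_inf_left U h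
    have := hb.coord_res inf_le_left h1 (res M inf_le_right s) i
    rw [hs i hi, map_zero] at this
    simpa using this
  mem_of_local {V s} hs i hi := by
    by_cases hV : Nonempty V
    · obtain ⟨x, hx⟩ := hV
      obtain ⟨W, h, hxW, hW⟩ := hs x hx
      have : Nonempty W := ⟨⟨x, hxW⟩⟩
      have h1 : U ⊓ W ≤ U ⊓ V := inf_le_inf_left U h
      apply map_injective h1
      rw [map_zero, ← hb.coord_res inf_le_left h1]
      simpa using hW i hi
    · have := subsingleton_sections (X := X) (V := U ⊓ V) fun ⟨x⟩ ↦ hV ⟨⟨x.1, x.2.2⟩⟩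
      exact Subsingleton.elim _ _

/-- In terms of a frame `e` with `e 0` in the saturation, the saturation consists of the multiples
of `e 0`. -/
lemma IsFrame.mem_saturation_iff (hb : IsFrame M U b) {V : X.Opens} {e : Fin (n + 1) → Γ(M, V)}
    (he : IsFrame M V e) (he0 : e 0 ∈ hb.saturation.obj V) {W : X.Opens} (h : W ≤ V)
    (a : Fin (n + 1) → Γ(X, W)) :
    ∑ i, a i • res M h (e i) ∈ hb.saturation.obj W ↔ ∀ i, i ≠ 0 → a i = 0 := by
  constructor
  · intro hs
    by_cases hW : Nonempty W
    swap
    · have := subsingleton_sections hW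
      exact fun i _ ↦ Subsingleton.elim _ _
    have hU : U ⊓ W ≤ U := inf_le_left
    have hWr : U ⊓ W ≤ W := inf_le_right
    have key : ∀ {s : Γ(M, W)}, s ∈ hb.saturation.obj W →
        res M hWr s = hb.coord hU (res M hWr s) 0 • res M hU (b 0) := by
      intro s hs
      conv_lhs => rw [← hb.sum_coord hU (res M hWr s)]
      exact Finset.sum_eq_single 0 (fun i _ hi ↦ by rw [hs i hi, zero_smul]) (by simp)
    have h0 := key (hb.saturation.res_mem h he0)
    have h1 := key hs
    set c := hb.coord hU (res M hWr (∑ i, a i • res M h (e i))) 0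
    set c₀ := hb.coord hU (res M hWr (res M h (e 0))) 0
    have hc₀ : c₀ ≠ 0 := by
      intro hc
      rw [hc, zero_smul, res_res] at h0
      have := he.eq_of_sum_eq (hWr.trans h) (a := Pi.single 0 1) (a' := 0)
        (by simp [Pi.single_apply, ite_smul, h0])
      have := congrFun this 0
      simp at this
    have h2 : ∑ i, (c₀ * X.presheaf.map (homOfLE hWr).op (a i)) • res M (hWr.trans h) (e i) =
        ∑ i, (Pi.single 0 c : Fin (n + 1) → Γ(X, U ⊓ W)) i • res M (hWr.trans h) (e i) := by
      have h3 := congrArg (c₀ • ·) h1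
      have h4 := congrArg (c • ·) h0
      simp only [smul_smul, res_res] at h3 h4
      rw [mul_comm c₀ c, ← h4] at h3
      simpa [Finset.smul_sum, smul_smul, Pi.single_apply, ite_smul] using h3
    intro i hi
    have := congrFun (he.eq_of_sum_eq (hWr.trans h) h2) i
    simp only [Pi.single_apply, hi, if_false] at this
    apply map_injective hWr
    rw [map_zero]
    exact (mul_eq_zero.mp this).resolve_left hc₀
  · intro ha
    rw [Finset.sum_eq_single 0 (fun i _ hi ↦ by rw [ha i hi, zero_smul]) (by simp)]
    exact Submodule.smul_mem _ _ (hb.saturation.res_mem h he0)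

lemma IsFrame.saturation_shortExact (hb : IsFrame M U b) :
    (ShortComplex.mk hb.saturation.ι (cokernel.π hb.saturation.ι)
      (cokernel.condition _)).ShortExact where
  exact := ShortComplex.exact_cokernel _
  mono_f := inferInstanceAs (Mono hb.saturation.ι)
  epi_g := inferInstanceAs (Epi (cokernel.π hb.saturation.ι))

lemma IsFrame.π_app_eq_zero_iff (hb : IsFrame M U b) {V : X.Opens} (s : Γ(M, V)) :
    (cokernel.π hb.saturation.ι).app V s = 0 ↔ s ∈ hb.saturation.obj V := by
  constructor
  · intro h
    have := hb.saturation_shortExact.mono_f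
    obtain ⟨t, ht⟩ := exists_app_eq_of_exact hb.saturation_shortExact.exact (s := s) h
    rw [← ht]
    exact hb.saturation.ι_app_mem t
  · intro h
    obtain ⟨t, rfl⟩ := hb.saturation.exists_ι_app_eq h
    exact g_app_f_app (ShortComplex.mk hb.saturation.ι (cokernel.π hb.saturation.ι)
      (cokernel.condition _)) t

lemma IsFrame.isFrame_saturation (hb : IsFrame M U b) {V : X.Opens} {e : Fin (n + 1) → Γ(M, V)}
    (he : IsFrame M V e) (he0 : e 0 ∈ hb.saturation.obj V) :
    ∃ f : Fin 1 → Γ(hb.saturation.toModules, V), IsFrame hb.saturation.toModules V f := by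
  obtain ⟨t, ht⟩ := hb.saturation.exists_ι_app_eq he0
  refine ⟨fun _ ↦ t, fun W h ↦ ⟨fun a a' haa' ↦ ?_, fun s ↦ ?_⟩⟩
  · have := congrArg (hb.saturation.ι.app W) haa'
    simp only [Finset.univ_unique, Finset.sum_singleton, Scheme.Modules.Hom.app_smul, app_res,
      ht] at this
    have := he.eq_of_sum_eq h (a := Pi.single 0 (a 0)) (a' := Pi.single 0 (a' 0))
      (by simpa [Pi.single_apply, ite_smul] using this)
    have := congrFun this 0
    simp only [Pi.single_eq_same] at this
    funext i
    rw [Subsingleton.elim i 0, this]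
  · have hs := hb.saturation.ι_app_mem s
    obtain ⟨a, ha⟩ := (he W h).2 (hb.saturation.ι.app W s)
    simp only at ha
    rw [← ha, hb.mem_saturation_iff he he0] at hs
    refine ⟨fun _ ↦ a 0, hb.saturation.ι_app_injective W ?_⟩
    rw [← ha, Finset.sum_eq_single 0 (fun i _ hi ↦ by rw [hs i hi, zero_smul]) (by simp)]
    simp [ht]

lemma IsFrame.isFrame_cokernel_saturation (hb : IsFrame M U b) {V : X.Opens}
    {e : Fin (n + 1) → Γ(M, V)} (he : IsFrame M V e) (he0 : e 0 ∈ hb.saturation.obj V) :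
    IsFrame (cokernel hb.saturation.ι) V
      fun i : Fin n ↦ (cokernel.π hb.saturation.ι).app V (e i.succ) := by
  refine IsFrame.of_locally (fun W h a ha ↦ ?_) (fun W h q x hx ↦ ?_)
  · have h1 : (cokernel.π hb.saturation.ι).app W
        (∑ i, (Fin.cons 0 a : Fin (n + 1) → Γ(X, W)) i • res M h (e i)) = 0 := by
      simpa [Fin.sum_univ_succ] using ha
    rw [hb.π_app_eq_zero_iff, hb.mem_saturation_iff he he0] at h1
    funext i
    simpa using h1 i.succ (Fin.succ_ne_zero i)
  · obtain ⟨Y, hY, hxY, s, hs⟩ := exists_app_eq_res (cokernel.π hb.saturation.ι) q hx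
    refine ⟨Y, hY, hxY, fun i ↦ he.coord (hY.trans h) s i.succ, ?_⟩
    rw [← hs]
    conv_rhs => rw [← he.sum_coord (hY.trans h) s, Fin.sum_univ_succ]
    have h0 : (cokernel.π hb.saturation.ι).app Y (res M (hY.trans h) (e 0)) = 0 :=
      (hb.π_app_eq_zero_iff _).mpr (hb.saturation.res_mem (hY.trans h) he0)
    rw [app_res] at h0
    simp [h0]

end Saturation

/-- Over a valuation ring, every nonzero vector over the fraction field is a multiple of an
integral vector with some coordinate `1`. -/
lemma exists_coord_dvd (R : Type*) {L ι : Type*} [CommRing R] [IsDomain R] [ValuationRing R]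
    [Field L] [Algebra R L] [IsFractionRing R L] [Finite ι] {c : ι → L} (hc : c ≠ 0) :
    ∃ i₀, c i₀ ≠ 0 ∧ ∃ r : ι → R, r i₀ = 1 ∧ ∀ i, c i = c i₀ * algebraMap R L (r i) := by
  classical
  obtain ⟨j, hj⟩ := Function.ne_iff.mp hc
  have : Nonempty ι := ⟨j⟩
  obtain ⟨i₀, h₀⟩ := Finite.exists_max fun i ↦ ValuationRing.valuation R L (c i)
  have hi₀ : c i₀ ≠ 0 := by
    intro h
    have := h₀ j
    rw [h, map_zero, le_zero_iff, map_eq_zero] at this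
    exact hj this
  have h (i : ι) : ∃ r : R, algebraMap R L r = c i / c i₀ := by
    rw [← ValuationRing.mem_integer_iff, Valuation.mem_integer_iff, map_div₀]
    exact div_le_one_of_le₀ (h₀ i) zero_le
  choose r hr using h
  refine ⟨i₀, hi₀, r, FaithfulSMul.algebraMap_injective R L ?_, fun i ↦ ?_⟩
  · rw [hr, div_self hi₀, map_one]
  · rw [hr, mul_div_cancel₀ _ hi₀]

section Spread

variable {X : Scheme.{u}}

lemma exists_germ_eq_of_finite {ι : Type*} [Finite ι] {x : X} (r : ι → X.presheaf.stalk x)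
    {V : X.Opens} (hx : x ∈ V) : ∃ (W : X.Opens) (_ : W ≤ V) (hxW : x ∈ W) (g : ι → Γ(X, W)),
      ∀ i, X.presheaf.germ W x hxW (g i) = r i := by
  have := Fintype.ofFinite ι
  choose Y hxY t ht using fun i ↦ X.presheaf.exists_germ_eq (r i)
  have hxW : x ∈ Finset.univ.inf Y ⊓ V := by
    refine ⟨?_, hx⟩
    rw [TopologicalSpace.Opens.coe_finset_inf]
    simpa using hxY
  have hW (i : ι) : Finset.univ.inf Y ⊓ V ≤ Y i :=
    inf_le_left.trans (Finset.inf_le (Finset.mem_univ i))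
  refine ⟨_, inf_le_right, hxW, fun i ↦ X.presheaf.map (homOfLE (hW i)).op (t i), fun i ↦ ?_⟩
  rw [← ht]
  exact TopCat.Presheaf.germ_res_apply X.presheaf _ _ _ _

end Spread

section Frame

variable {X : Scheme.{u}} {M : X.Modules} {n : ℕ} {V : X.Opens}

lemma IsFrame.reindex {f : Fin n → Γ(M, V)} (hf : IsFrame M V f) (σ : Equiv.Perm (Fin n)) :
    IsFrame M V (f ∘ σ) := by
  intro W h
  convert (hf W h).comp (Equiv.arrowCongr σ (Equiv.refl Γ(X, W))).bijective using 1
  funext a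
  simp only [Function.comp_apply, Equiv.arrowCongr_apply, Equiv.coe_refl, id]
  exact Fintype.sum_equiv σ _ _ (by simp)

/-- Replacing `f i₀` by a linear combination with coefficient `1` at `f i₀`. -/
lemma IsFrame.replace {f : Fin n → Γ(M, V)} (hf : IsFrame M V f) {i₀ : Fin n}
    {g : Fin n → Γ(X, V)} (hg : g i₀ = 1) :
    IsFrame M V (Function.update f i₀ (∑ i, g i • f i)) := by
  intro W h
  let g' (i : Fin n) : Γ(X, W) := if i = i₀ then 0 else X.presheaf.map (homOfLE h).op (g i)
  let σ : (Fin n → Γ(X, W)) ≃ (Fin n → Γ(X, W)) :=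
    { toFun := fun a i ↦ a i + a i₀ * g' i
      invFun := fun a i ↦ a i - a i₀ * g' i
      left_inv := fun a ↦ by funext i; simp [g']
      right_inv := fun a ↦ by funext i; simp [g'] }
  convert (hf W h).comp σ.bijective using 1
  funext a
  have h1 (i : Fin n) : a i • res M h (Function.update f i₀ (∑ i, g i • f i) i) =
      a i • res M h (f i) + if i = i₀ then a i₀ • ∑ j, g' j • res M h (f j) else 0 := by
    by_cases hi : i = i₀
    · subst hi
      simp only [Function.update_self, if_true, res_sum, res_smul]
      rw [← smul_add, ← Finset.add_sum_erase _ _ (Finset.mem_univ i), hg, map_one, one_smul,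
        ← Finset.add_sum_erase (f := fun j ↦ g' j • res M h (f j)) _ (Finset.mem_univ i)]
      simp only [g', if_true, zero_smul, zero_add]
      congr 2
      exact Finset.sum_congr rfl fun j hj ↦ by rw [if_neg (Finset.ne_of_mem_erase hj)]
    · simp [hi]
  simp only [h1, Function.comp_apply, σ, Equiv.coe_fn_mk, Finset.sum_add_distrib, add_smul,
    Finset.sum_ite_eq', Finset.mem_univ, if_true, Finset.smul_sum, smul_smul]

lemma IsFrame.ne_zero [Nonempty V] {b : Fin n → Γ(M, V)} (hb : IsFrame M V b) (i : Fin n) :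
    b i ≠ 0 := by
  intro h
  have := hb.eq_of_sum_eq le_rfl (a := Pi.single i 1) (a' := 0)
    (by simp [Pi.single_apply, ite_smul, h])
  have := congrFun this i
  simp at this

lemma Subbundle.shortExact {k : ℕ} (F : Subbundle M k) :
    (ShortComplex.mk F.ι (cokernel.π F.ι) (cokernel.condition _)).ShortExact where
  exact := ShortComplex.exact_cokernel _
  mono_f := F.mono
  epi_g := inferInstanceAs (Epi (cokernel.π F.ι))

end Frame

section Integral

variable {X : Scheme.{u}} [IsIntegral X] {M : X.Modules} {n : ℕ} {U : X.Opens} [Nonempty U]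
  {b : Fin (n + 1) → Γ(M, U)}

/-- A section of which `b 0` is generically a multiple lies in the saturation of `b 0`. -/
lemma IsFrame.mem_saturation_of_smul_eq (hb : IsFrame M U b) {V : X.Opens} [Nonempty V]
    {s : Γ(M, V)} {c : Γ(X, U ⊓ V)}
    (h : res M inf_le_left (b 0) = c • res M inf_le_right s) : s ∈ hb.saturation.obj V := by
  have hc : c ≠ 0 := by
    rintro rfl
    rw [zero_smul] at h
    exact (hb.restrict inf_le_left).ne_zero 0 h
  intro i hi
  have h1 : hb.coord (inf_le_left : U ⊓ V ≤ U) (res M inf_le_left (b 0)) = Pi.single 0 1 :=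
    hb.coord_eq _ (by simp [Pi.single_apply, ite_smul])
  rw [h] at h1
  have h2 := congrFun h1 i
  rw [hb.coord_smul, Pi.single_eq_of_ne hi] at h2
  exact (mul_eq_zero.mp h2).resolve_left hc

lemma IsFrame.exists_frame_mem_saturation (hb : IsFrame M U b) {x : X}
    [IsPrincipalIdealRing (X.presheaf.stalk x)] {V : X.Opens} (hx : x ∈ V)
    {f : Fin (n + 1) → Γ(M, V)} (hf : IsFrame M V f) :
    ∃ (W : X.Opens) (e : Fin (n + 1) → Γ(M, W)), x ∈ W ∧ IsFrame M W e ∧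
      e 0 ∈ hb.saturation.obj W := by
  have : Nonempty V := ⟨⟨x, hx⟩⟩
  let a := hf.coord (inf_le_right : U ⊓ V ≤ V) (res M inf_le_left (b 0))
  have ha : ∑ i, a i • res M inf_le_right (f i) = res M inf_le_left (b 0) := hf.sum_coord _ _
  have hc : (fun i ↦ X.germToFunctionField (U ⊓ V) (a i)) ≠ 0 := by
    intro h
    have h0 : ∀ i, a i = 0 := fun i ↦
      X.germToFunctionField_injective (U ⊓ V) ((congrFun h i).trans (map_zero _).symm)
    refine (hb.restrict (inf_le_left : U ⊓ V ≤ U)).ne_zero 0 ?_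
    rw [← ha]
    simp [h0]
  obtain ⟨i₀, -, r, hr₀, hr⟩ := exists_coord_dvd (X.presheaf.stalk x) hc
  obtain ⟨W, hWV, hxW, g, hg⟩ := exists_germ_eq_of_finite r hx
  have : Nonempty W := ⟨⟨x, hxW⟩⟩
  have hgr (i : Fin (n + 1)) : X.germToFunctionField W (g i) = algebraMap _ _ (r i) := by
    rw [← hg, Scheme.algebraMap_germ_eq_germToFunctionField]
  have hg₀ : g i₀ = 1 := X.germToFunctionField_injective W (by rw [hgr, hr₀, map_one, map_one])
  have he := ((hf.restrict hWV).replace hg₀).reindex (Equiv.swap 0 i₀)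
  refine ⟨W, _, hxW, he, ?_⟩
  have hUW : U ⊓ W ≤ U ⊓ V := inf_le_inf_left U hWV
  refine hb.mem_saturation_of_smul_eq (c := X.presheaf.map (homOfLE hUW).op (a i₀)) ?_
  have h1 := congrArg (res M hUW) ha
  simp only [res_sum, res_smul, res_res] at h1
  rw [← h1]
  simp only [Function.comp_apply, Equiv.swap_apply_left, Function.update_self, res_sum, res_smul,
    res_res, Finset.smul_sum, smul_smul]
  refine Finset.sum_congr rfl fun i _ ↦ ?_
  congr 1
  apply X.germToFunctionField_injective (U ⊓ W)
  rw [map_mul, germToFunctionField_res, germToFunctionField_res, germToFunctionField_res, hgr, hr i]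

lemma Subbundle.isVectorBundle_quotient {k q : ℕ} (F : Subbundle M k)
    (hM : IsVectorBundle (k + q) M) : IsVectorBundle q F.quotient := by
  obtain ⟨q', hq'⟩ := F.exists_isVectorBundle_cokernel
  have h := IsVectorBundle.of_shortExact F.shortExact F.isVectorBundle hq'
  obtain ⟨V, hx, f, hf⟩ := h (genericPoint X)
  have : Nonempty V := ⟨⟨_, hx⟩⟩
  have := hM.rank_eq hf
  obtain rfl : q = q' := by omega
  exact hq'

variable [∀ x : X, IsPrincipalIdealRing (X.presheaf.stalk x)]

/-- The line subbundle of `M` generated by the rational section `b 0`. -/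
noncomputable def IsFrame.lineSubbundle (hb : IsFrame M U b) (hM : IsVectorBundle (n + 1) M) :
    Subbundle M 1 where
  obj := hb.saturation.toModules
  ι := hb.saturation.ι
  mono := inferInstance
  isVectorBundle x := by
    obtain ⟨V, hx, f, hf⟩ := hM x
    obtain ⟨W, e, hxW, he, he0⟩ := hb.exists_frame_mem_saturation hx hf
    exact ⟨W, hxW, hb.isFrame_saturation he he0⟩
  exists_isVectorBundle_cokernel := ⟨n, fun x ↦ by
    obtain ⟨V, hx, f, hf⟩ := hM x
    obtain ⟨W, e, hxW, he, he0⟩ := hb.exists_frame_mem_saturation hx hf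
    exact ⟨W, hxW, _, hb.isFrame_cokernel_saturation he he0⟩⟩

/-- A vector bundle has subbundles of every positive rank up to its own. -/
theorem IsVectorBundle.nonempty_subbundle {ν q : ℕ} (hM : IsVectorBundle (ν + 1 + q) M) :
    Nonempty (Subbundle M (ν + 1)) := by
  induction ν generalizing M with
  | zero =>
    rw [zero_add, add_comm] at hM
    obtain ⟨V, hx, f, hf⟩ := hM (genericPoint X)
    have : Nonempty V := ⟨⟨_, hx⟩⟩
    exact ⟨hf.lineSubbundle hM⟩
  | succ ν ih =>
    rw [show ν + 1 + 1 + q = (ν + 1 + q) + 1 by omega] at hM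
    obtain ⟨V, hx, f, hf⟩ := hM (genericPoint X)
    have : Nonempty V := ⟨⟨_, hx⟩⟩
    rw [add_comm _ 1] at hM ⊢
    obtain ⟨G⟩ := ih ((hf.lineSubbundle (add_comm 1 _ ▸ hM)).isVectorBundle_quotient hM)
    exact ⟨(hf.lineSubbundle _).preimage G⟩

end Integral

section Segre

variable {X : Scheme.{u}} [IsIntegral X] [IsLocallyNoetherian X] {E : X.Modules} {r k : ℕ}

lemma Subbundle.IsMaximal.segre_eq {F : Subbundle E k} (hF : F.IsMaximal) :
    segre r k E = segreOf r E F := by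
  refine IsLeast.csInf_eq ⟨⟨F, rfl⟩, ?_⟩
  rintro _ ⟨G, rfl⟩
  have := mul_le_mul_of_nonneg_left (hF G) (Int.natCast_nonneg r)
  simp only [segreOf]
  linarith

/-- A lower bound for all `segreOf r E F` bounds `segre r k E` as soon as `E` has subbundles of
rank `k`. -/
lemma le_segre [Nonempty (Subbundle E k)] {q : ℚ}
    (h : ∀ F : Subbundle E k, q ≤ (segreOf r E F : ℚ)) : q ≤ (segre r k E : ℚ) := by
  rw [← Int.ceil_le]
  refine le_csInf (Set.range_nonempty _) ?_
  rintro _ ⟨F, rfl⟩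
  exact Int.ceil_le.mpr (h F)

lemma IsStableBundle.mul_degree_add_one_le {d : ℤ} (hE : IsStableBundle r d E) (hk : 1 ≤ k)
    (hkr : k < r) (F : Subbundle E k) : (r * degree F.obj + 1 : ℚ) ≤ k * d := by
  have h := hE.slope_lt k hk hkr F
  rw [hE.degree_eq, div_lt_div_iff₀ (Nat.cast_pos.mpr hk) (Nat.cast_pos.mpr (by omega))] at h
  have h' : degree F.obj * r < d * k := by exact_mod_cast h
  have : (r : ℤ) * degree F.obj + 1 ≤ k * d := by linarith
  exact_mod_cast this

end Segre

end CurveBundle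

theorem proposition4p3 {K : Type u} [Field K] [IsAlgClosed K]
    (C : CurveBundle.SmoothProjectiveCurve K) (r k : ℕ) (d s : ℤ) (hk : 1 ≤ k) (hkr : k < r)
    (E : C.X.Modules) (hE : CurveBundle.IsStableBundle r d E)
    (hs : CurveBundle.segre r k E = s)
    (F : CurveBundle.Subbundle E k) (hF : F.IsMaximal) :
    (∀ ν : ℕ, 1 ≤ ν → ν < k →
      ((k : ℚ) - ν * s) / r ≤ (CurveBundle.segre k ν F.obj : ℚ)) ∧
    (∀ ν : ℕ, 1 ≤ ν → ν < r - k →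
      (((r : ℚ) - k) - ((r : ℚ) - k - ν) * s) / r ≤
        (CurveBundle.segre (r - k) ν F.quotient : ℚ)) := by
  open CurveBundle in
  have hr : (0 : ℚ) < r := Nat.cast_pos.mpr (by omega)
  have hs' : (s : ℚ) = k * d - r * degree F.obj := by
    rw [← hs, hF.segre_eq, segreOf, hE.degree_eq]
    push_cast
    rfl
  have hquot : IsVectorBundle (r - k) F.quotient :=
    F.isVectorBundle_quotient (by rw [Nat.add_sub_cancel' hkr.le]; exact hE.isVectorBundle)
  refine ⟨fun ν hν hνk ↦ ?_, fun ν hν hνk ↦ ?_⟩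
  · have : Nonempty (Subbundle F.obj ν) := by
      obtain ⟨ν, rfl⟩ := Nat.exists_eq_add_of_le' hν
      obtain ⟨q, rfl⟩ := Nat.exists_eq_add_of_lt hνk
      exact IsVectorBundle.nonempty_subbundle (q := q + 1) F.isVectorBundle
    refine le_segre fun G ↦ ?_
    have h := hE.mul_degree_add_one_le hν (hνk.trans hkr) (F.trans G)
    replace h : (r * degree G.obj + 1 : ℚ) ≤ ν * d := h
    rw [div_le_iff₀ hr, segreOf, hs']
    push_cast
    nlinarith [mul_le_mul_of_nonneg_left h (Nat.cast_nonneg (α := ℚ) k)]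
  · have : Nonempty (Subbundle F.quotient ν) := by
      obtain ⟨ν, rfl⟩ := Nat.exists_eq_add_of_le' hν
      obtain ⟨q, hq⟩ := Nat.exists_eq_add_of_lt hνk
      rw [hq] at hquot
      exact IsVectorBundle.nonempty_subbundle (q := q + 1) hquot
    refine le_segre fun G ↦ ?_
    have h := hE.mul_degree_add_one_le (by omega) (by omega) (F.preimage G)
    have h₁ : degree (F.preimage G).obj = degree F.obj + degree G.obj :=
      degree_add (F.extension_shortExact G) F.isVectorBundle G.isVectorBundle
    have h₂ : degree E = degree F.obj + degree F.quotient :=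
      degree_add F.shortExact F.isVectorBundle hquot
    rw [hE.degree_eq] at h₂
    have h₂' : (d : ℚ) = degree F.obj + degree F.quotient := by exact_mod_cast h₂
    have hkr' : (0 : ℚ) ≤ r - k := by rw [sub_nonneg]; exact_mod_cast hkr.le
    rw [h₁] at h
    rw [div_le_iff₀ hr, segreOf, hs']
    push_cast [Nat.cast_sub hkr.le] at h ⊢
    rw [show (degree F.quotient : ℚ) = d - degree F.obj by linarith]
    nlinarith [mul_le_mul_of_nonneg_left h hkr']
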